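/- For $N\ge 1$, $\gamma>0$ and $\omega\in\mathbb R^N$ consider the Kuramoto model \[ \dot\theta_i=\omega_i-\frac{\gamma}{N}\sum_{j=1}^N\sin(\theta_i-\theta_j),\qquad i=1,\dots,N,\quad t\ge 0, \] and let $|\theta_i-\theta_j|$ denote the geodesic distance of phases on the circle $\mathbb R/2\pi\mathbb Z$. Fix a constant $c$, independent of $N$, with $2\arcsin\sqrt{1/6}\le c<\pi$. A set $S\subseteq\{1,\dots,N\}$ is a partially entrained cluster if there is a solution $\theta$ with $\limsup_{t\to\infty}|\theta_i(t)-\theta_j(t)|\le c$ for all $i,j\in S$; $N_{\mathrm{cluster}}$ is the largest cardinality of a partially entrained cluster. Let $f$ be a probability density on $\mathbb R$ that is symmetric ($f(-x)=f(x)$), (weakly) increasing on $(-\infty,0)$, (weakly) decreasing on $(0,\infty)$, has its maximum at $0$, and has support the whole line. Let $\omega_1,\dots,\omega_N$ be independent with density $f$. For $\rho\in(0,\tfrac12]$ let $g_\infty(\rho)\ge0$ be the unique number with $\int_{-g_\infty(\rho)/2}^{g_\infty(\rho)/2}f(x)\,dx=1-\rho$, and let \[ \tilde h(\rho)=\sqrt{\frac1{1-\rho}}\left(\frac{2-4\rho}{3}\right)^{3/2}.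 \] Then there is a smallest value $\gamma^*$ of $\gamma$ for which $g_\infty(\rho)=\gamma\tilde h(\rho)$ has a solution $\rho\in(0,\tfrac12]$, and $\gamma^*>0$. Moreover, with $\gamma$ independent of $N$: (i) For every $\gamma>\gamma^*$ there is $\delta>0$, independent of $N$, such that the probability that a partially entrained cluster with at least $\delta N$ oscillators exists tends to $1$ as $N\to\infty$. (ii) For every $\gamma>\gamma^*$ the equation $g_\infty(\rho)=\gamma\tilde h(\rho)$ has a smallest solution $\rho_{\min}\in(0,\tfrac12]$, and for every $\varepsilon>0$ there is a constant $C>0$, independent of $N$, with \[ \lim_{N\to\infty}\mathbb P\bigl(N_{\mathrm{cluster}}\ge(1-\rho_{\min})N-CN^{1/2+\varepsilon}\bigr)=1 . \] In addition there is $r\in(0,2\arcsin\sqrt{1/6}]$, independent of $N$ and $\varepsilon$, such that for every $\varepsilon>0$ there is $C>0$, independent of $N$, for which the following holds with probability tending to $1$: there is a set $S$ of at least $(1-\rho_{\min})N-CN^{1/2+\varepsilon}$ oscillators such that the region $\{|\theta_i-\theta_j|<r\ \ \forall i,j\in S\}$ is invariant in forward time. (iii) For every $\gamma>0$ and every $\varepsilon>0$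 there is a constant $C>0$, independent of $N$, with \[ \lim_{N\to\infty}\mathbb P\Bigl(N_{\mathrm{cluster}}\le N\int_{-\gamma}^{\gamma}f(x)\,dx+CN^{1/2+\varepsilon}\Bigr)=1 . \] (If an event is not known to be measurable, "probability tending to $1$" means that the outer measure of its complement tends to $0$.) -/

import Mathlib

open MeasureTheory Filter Topology

noncomputable section

namespace Kuramoto

/-- Geodesic distance on the circle `ℝ / 2πℤ` between the phases represented by `x` and `y`. -/
def phaseDist (x y : ℝ) : ℝ := |((x - y : ℝ) : Real.Angle).toReal|

/-- `θ` is a solution, for all times `t ≥ 0`, of the Kuramoto model with `N` oscillators, coupling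
strength `γ` and natural frequencies `ω`; `θ t i` is a real representative of the phase. -/
def IsSolution {N : ℕ} (γ : ℝ) (ω : Fin N → ℝ) (θ : ℝ → Fin N → ℝ) : Prop :=
  ∀ t : ℝ, 0 ≤ t → ∀ i : Fin N,
    HasDerivWithinAt (fun s => θ s i)
      (ω i - γ / (N : ℝ) * ∑ j : Fin N, Real.sin (θ t i - θ t j)) (Set.Ici 0) t

/-- The model admits a state in which the oscillators of `S` are partially entrained with
constant `c`. The geodesic distance takes values in `[0, π]`, so the `limsup` is a genuine one. -/
def IsEntrained {N : ℕ} (γ : ℝ) (ω : Fin N → ℝ) (c : ℝ) (S : Finset (Fin N)) : Prop :=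
  ∃ θ : ℝ → Fin N → ℝ, IsSolution γ ω θ ∧
    ∀ i ∈ S, ∀ j ∈ S, limsup (fun t : ℝ => phaseDist (θ t i) (θ t j)) atTop ≤ c

/-- The region where the phases of the oscillators of `S` are pairwise at distance `< r` is
invariant in forward time. -/
def IsInvariantRegion {N : ℕ} (γ : ℝ) (ω : Fin N → ℝ) (r : ℝ) (S : Finset (Fin N)) : Prop :=
  ∀ θ : ℝ → Fin N → ℝ, IsSolution γ ω θ →
    (∀ i ∈ S, ∀ j ∈ S, phaseDist (θ 0 i) (θ 0 j) < r) →
    ∀ t : ℝ, 0 ≤ t → ∀ i ∈ S, ∀ j ∈ S, phaseDist (θ t i) (θ t j) < r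

/-- The number of oscillators in the largest partially entrained cluster. -/
def clusterSize {N : ℕ} (γ : ℝ) (ω : Fin N → ℝ) (c : ℝ) : ℕ :=
  sSup {n : ℕ | ∃ S : Finset (Fin N), IsEntrained γ ω c S ∧ S.card = n}

/-- Symmetric unimodal probability densities supported on the whole line, with maximum at `0`. -/
structure IsSymmUnimodalDensity (f : ℝ → ℝ) : Prop where
  nonneg : ∀ x, 0 ≤ f x
  integrable : Integrable f
  integral_eq_one : ∫ x, f x = 1
  full_support : tsupport f = Set.univ
  symmetric : ∀ x, f (-x) = f x
  increasing : MonotoneOn f (Set.Iio 0)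
  decreasing : AntitoneOn f (Set.Ioi 0)
  max_at_zero : ∀ x, f x ≤ f 0

/-- The joint law of `N` independent frequencies with density `f`. -/
def freqLaw (f : ℝ → ℝ) (N : ℕ) : Measure (Fin N → ℝ) :=
  Measure.pi fun _ : Fin N => volume.withDensity fun x => ENNReal.ofReal (f x)

/-- The events `E N`, in the space of the frequencies of `N` oscillators, have probability tending
to `1`. Since the measure of a set that is not known to be measurable is its outer measure, this is
said through the complements, which gives the limit `1` even for the inner measure of `E N`. -/
def WithHighProbability (f : ℝ → ℝ) (E : (N : ℕ) → (Fin N → ℝ) → Prop) : Prop :=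
  Tendsto (fun N : ℕ => freqLaw f N {ω | ¬ E N ω}) atTop (𝓝 0)

/-- `g_∞(ρ)`: the number `x ≥ 0` with `∫_{-x/2}^{x/2} f = 1 - ρ`
(it exists and is unique for `0 < ρ ≤ 1`, see `gInf_eq_iff`). -/
def gInf (f : ℝ → ℝ) (ρ : ℝ) : ℝ :=
  sInf {x : ℝ | 0 ≤ x ∧ ∫ w in (-(x / 2))..(x / 2), f w = 1 - ρ}

/-- The function `h̃(ρ)`. -/
def hTilde (ρ : ℝ) : ℝ := Real.sqrt (1 / (1 - ρ)) * ((2 - 4 * ρ) / 3) ^ (3 / 2 : ℝ)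

/-- The solutions `ρ ∈ (0, 1/2]` of `g_∞(ρ) = γ h̃(ρ)`. -/
def intersections (f : ℝ → ℝ) (γ : ℝ) : Set ℝ :=
  {ρ : ℝ | ρ ∈ Set.Ioc (0 : ℝ) (1 / 2) ∧ gInf f ρ = γ * hTilde ρ}

/-- The threshold `γ*`. -/
def gammaStar (f : ℝ → ℝ) : ℝ := sInf {γ : ℝ | (intersections f γ).Nonempty}

/-- `ρ_min`, the smallest solution. -/
def rhoMin (f : ℝ → ℝ) (γ : ℝ) : ℝ := sInf (intersections f γ)

theorem IsSymmUnimodalDensity.pos {f : ℝ → ℝ} (hf : IsSymmUnimodalDensity f) (x : ℝ) :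
    0 < f x := by
  rcases (hf.nonneg x).lt_or_eq with h | h
  · exact h
  exfalso
  have key : ∀ y : ℝ, |x| < y → f y = 0 := by
    intro y hy
    have h1 : f |x| = 0 := by
      rcases abs_choice x with hx | hx <;> rw [hx]
      · exact h.symm
      · rw [hf.symmetric]; exact h.symm
    have h2 : f y ≤ f |x| := by
      rcases (abs_nonneg x).lt_or_eq with h3 | h3
      · exact hf.decreasing h3 (h3.trans hy) hy.le
      · rw [← h3]; exact hf.max_at_zero y
    exact le_antisymm (h2.trans h1.le) (hf.nonneg y)
  have hd : Dense (Function.support f) := by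
    intro y
    have : y ∈ tsupport f := by rw [hf.full_support]; trivial
    exact this
  obtain ⟨y, hy1, hy2⟩ :=
    hd.exists_mem_open (isOpen_Ioi (a := |x|)) ⟨|x| + 1, lt_add_one |x|⟩
  exact hy1 (key y hy2)

/-- `g_∞(ρ)` is well defined by its implicit equation. -/
theorem gInf_eq_iff {f : ℝ → ℝ} (hf : IsSymmUnimodalDensity f) {ρ : ℝ} (h0 : 0 < ρ) (h1 : ρ ≤ 1)
    (x : ℝ) :
    gInf f ρ = x ↔ 0 ≤ x ∧ ∫ w in (-(x / 2))..(x / 2), f w = 1 - ρ := by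
  set I : ℝ → ℝ := fun x => ∫ w in (-(x / 2))..(x / 2), f w with hI
  have hii : ∀ a b : ℝ, IntervalIntegrable f volume a b := fun a b => hf.integrable.intervalIntegrable
  have hmono : StrictMonoOn I (Set.Ici 0) := by
    intro a ha b hb hab
    have ha' : (0 : ℝ) ≤ a := ha
    have e : I b = (∫ w in (-(b / 2))..(-(a / 2)), f w) + I a + ∫ w in (a / 2)..(b / 2), f w := by
      simp only [hI]
      rw [intervalIntegral.integral_add_adjacent_intervals (hii _ _) (hii _ _),
        intervalIntegral.integral_add_adjacent_intervals (hii _ _) (hii _ _)]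
    have p1 : 0 < ∫ w in (-(b / 2))..(-(a / 2)), f w :=
      intervalIntegral.intervalIntegral_pos_of_pos (hii _ _) hf.pos (by linarith)
    have p2 : 0 < ∫ w in (a / 2)..(b / 2), f w :=
      intervalIntegral.intervalIntegral_pos_of_pos (hii _ _) hf.pos (by linarith)
    linarith
  have hcont : Continuous I := by
    have hc : Continuous fun b => ∫ w in (0 : ℝ)..b, f w :=
      intervalIntegral.continuous_primitive hii 0
    have e : I = fun x => (∫ w in (0 : ℝ)..(x / 2), f w) - ∫ w in (0 : ℝ)..(-(x / 2)), f w := by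
      funext x
      exact (intervalIntegral.integral_interval_sub_left (hii _ _) (hii _ _)).symm
    rw [e]
    exact (hc.comp (by fun_prop)).sub (hc.comp (by fun_prop))
  have hlim : Tendsto I atTop (𝓝 1) := by
    have t : Tendsto (fun x : ℝ => x / 2) atTop atTop := tendsto_id.atTop_div_const (by norm_num)
    have := intervalIntegral_tendsto_integral hf.integrable (tendsto_neg_atTop_atBot.comp t) t
    rw [hf.integral_eq_one] at this
    exact this
  obtain ⟨y, hy0, hy⟩ : ∃ y : ℝ, 0 ≤ y ∧ I y = 1 - ρ := by
    obtain ⟨b, hb0, hb⟩ :=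
      ((eventually_ge_atTop (0 : ℝ)).and (hlim.eventually (lt_mem_nhds (by linarith : 1 - ρ < 1)))).exists
    have hz : I 0 = 0 := by simp [hI]
    obtain ⟨y, hy, e⟩ := intermediate_value_Icc hb0 hcont.continuousOn
      (show 1 - ρ ∈ Set.Icc (I 0) (I b) from ⟨by rw [hz]; linarith, hb.le⟩)
    exact ⟨y, hy.1, e⟩
  have hset : {x : ℝ | 0 ≤ x ∧ ∫ w in (-(x / 2))..(x / 2), f w = 1 - ρ} = {y} := by
    ext z
    constructor
    · rintro ⟨hz0, hz⟩
      exact hmono.injOn hz0 hy0 (hz.trans hy.symm)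
    · rintro rfl
      exact ⟨hy0, hy⟩
  have hg : gInf f ρ = y := by rw [gInf, hset, csInf_singleton]
  rw [hg]
  constructor
  · rintro rfl
    exact ⟨hy0, hy⟩
  · intro hx
    have : x ∈ ({y} : Set ℝ) := hset ▸ hx
    exact (Set.mem_singleton_iff.mp this).symm

end Kuramoto

end

/-! Lower bound. Let `S` have phase diameter exactly `r`, attained by `i` and `j`. Sum-to-product
turns the coupling difference into `2 sin(r/2)` times a sum of cosines: at least `cos(r/2)` for each
member of `S`, at least `-1` for each outsider (`le_sum_sin_sub_sin`). If this attraction beats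
every frequency gap in `S`, the diameter cannot reach `r`, and the region is invariant
(`IsSolution.sub_lt`). Take for `S` the oscillators with frequency in the central interval of length
`x = g_∞(ρ)`, about `(1 - ρ) N` of them. With `s = sin(r/2)`, weakening `cos(r/2)` to `cos r = 1 - 2
s²` and maximising over `s` gives `γ h̃(ρ)`. So at an intersection the true attraction strictly
exceeds `x`, and the slack absorbs the random fluctuations of `|S|` (`exists_radius_and_fraction`).

Upper bound. The coupling changes a phase difference at rate at most `2γ`. A frequency gap above
`2γ` therefore forces the difference through odd multiples of `π` forever, where the distance is `π
> c`. A cluster thus fits into a window of length `2γ`. By unimodality the central window is the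
likeliest; Hoeffding's inequality and a union bound over a grid of mesh `1/N` control all windows at
once (`whp_forall_window`).

Threshold. Parametrised by `x`, an intersection is a solution of `γ q(x) = 1`, where `q(x) = h̃(1 -
I(x)) / x` is continuous, vanishes at both ends and is positive between. Hence `γ* = 1 / max q`, and
the smallest `ρ` corresponds to the largest solution `x`. -/

namespace Kuramoto

/-! ### Global existence of solutions -/

section GlobalFlow

variable {E : Type*} [NormedAddCommGroup E] [NormedSpace ℝ E] [CompleteSpace E]

/-- A bounded Lipschitz vector field has an integral curve on `[0, T]` from every point. -/
theorem exists_integralCurve_Icc {v : E → E} {K L : NNReal} (hv : LipschitzWith K v)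
    (hL : ∀ x, ‖v x‖ ≤ L) (x₀ : E) (T : NNReal) :
    ∃ α : ℝ → E, α 0 = x₀ ∧
      ∀ t ∈ Set.Icc (0 : ℝ) T, HasDerivWithinAt α (v (α t)) (Set.Icc 0 T) t := by
  -- The speed is at most `L`, so a ball of radius `L * T` confines the curve up to time `T`,
  -- however large `T` is.
  have hp : IsPicardLindelof (fun _ => v) (tmin := 0) (tmax := T)
      ⟨0, le_refl 0, T.2⟩ x₀ (L * T) 0 L K :=
    { lipschitzOnWith := fun _ _ => hv.lipschitzOnWith
      continuousOn := fun _ _ => continuousOn_const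
      norm_le := fun _ _ x _ => hL x
      mul_max_le := by simp }
  obtain ⟨α, h0, h⟩ := hp.exists_eq_forall_mem_Icc_hasDerivWithinAt₀
  exact ⟨α, h0, h⟩

/-- A bounded Lipschitz vector field has an integral curve on `[0, ∞)` from every point. -/
theorem exists_integralCurve_Ici {v : E → E} {K L : NNReal} (hv : LipschitzWith K v)
    (hL : ∀ x, ‖v x‖ ≤ L) (x₀ : E) :
    ∃ α : ℝ → E, α 0 = x₀ ∧
      ∀ t, 0 ≤ t → HasDerivWithinAt α (v (α t)) (Set.Ici 0) t := by
  choose α h0 hα using fun n : ℕ => exists_integralCurve_Icc hv hL x₀ (n + 1)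
  push_cast at hα
  have agree : ∀ m n : ℕ, m ≤ n → Set.EqOn (α m) (α n) (Set.Icc 0 (m + 1)) := by
    intro m n hmn
    have hmn' : (m : ℝ) ≤ n := by exact_mod_cast hmn
    have hsub : Set.Icc (0 : ℝ) (m + 1) ⊆ Set.Icc (0 : ℝ) (n + 1) :=
      Set.Icc_subset_Icc_right (by linarith)
    have key : ∀ k : ℕ, (m : ℝ) ≤ k → ∀ t ∈ Set.Ico (0 : ℝ) (m + 1),
        HasDerivWithinAt (α k) (v (α k t)) (Set.Ici t) t := by
      intro k hk t ht
      refine (hα k t ⟨ht.1, by linarith [ht.2]⟩).mono_of_mem_nhdsWithin ?_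
      refine mem_of_superset (Icc_mem_nhdsGE (show t < k + 1 by linarith [ht.2])) ?_
      exact Set.Icc_subset_Icc_left ht.1
    refine ODE_solution_unique (v := fun _ => v) (fun _ => hv) (fun t ht => ?_)
      (key m le_rfl) (fun t ht => ?_) (key n hmn') ((h0 m).trans (h0 n).symm)
    · exact (hα m t ht).continuousWithinAt
    · exact ((hα n t (hsub ht)).mono hsub).continuousWithinAt
  -- The curve with index `⌊t⌋₊` lives up to `⌊t⌋₊ + 1 > t`, so near `t` the glued curve agrees with
  -- a single `α n`, even at integer times.
  refine ⟨fun t => α ⌊t⌋₊ t, by simp [h0], fun t ht => ?_⟩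
  have hlt : t < (⌊t⌋₊ : ℝ) + 1 := Nat.lt_floor_add_one t
  have hd : HasDerivWithinAt (α ⌊t⌋₊) (v (α ⌊t⌋₊ t)) (Set.Ici 0) t := by
    refine (hα ⌊t⌋₊ t ⟨ht, hlt.le⟩).mono_of_mem_nhdsWithin ?_
    rw [← Set.Ici_inter_Iic]
    exact inter_mem_nhdsWithin _ (Iic_mem_nhds hlt)
  refine hd.congr_of_eventuallyEq ?_ rfl
  filter_upwards [inter_mem_nhdsWithin (Set.Ici 0) (Iio_mem_nhds hlt)] with s hs
  refine agree _ _ ?_ ⟨hs.1, (Nat.lt_floor_add_one s).le⟩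
  have h1 : s < ((⌊t⌋₊ + 1 : ℕ) : ℝ) := by push_cast; exact hs.2
  exact Nat.lt_add_one_iff.mp ((Nat.floor_lt hs.1).mpr h1)

end GlobalFlow

variable {N : ℕ}

/-- The Kuramoto model has a solution, for all `t ≥ 0`, from every initial condition. -/
theorem exists_isSolution (γ : ℝ) (ω x₀ : Fin N → ℝ) :
    ∃ θ : ℝ → Fin N → ℝ, θ 0 = x₀ ∧ IsSolution γ ω θ := by
  set v : (Fin N → ℝ) → Fin N → ℝ :=
    fun x i => ω i - γ / (N : ℝ) * ∑ j : Fin N, Real.sin (x i - x j) with hv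
  have hcard : ∀ (i : Fin N) (b : ℝ), |γ / (N : ℝ)| * (N * b) = |γ| * b := by
    intro i b
    have : (0 : ℝ) < N := by exact_mod_cast i.pos
    rw [abs_div, abs_of_pos this]
    field_simp
  have hlip : LipschitzWith (Real.toNNReal (2 * |γ|)) v := by
    refine LipschitzWith.of_dist_le_mul fun x y => ?_
    rw [Real.coe_toNNReal _ (by positivity)]
    refine (dist_pi_le_iff (by positivity)).mpr fun i => ?_
    have e : v x i - v y i
        = -(γ / (N : ℝ) * ∑ j : Fin N, (Real.sin (x i - x j) - Real.sin (y i - y j))) := by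
      simp only [hv, Finset.sum_sub_distrib]; ring
    rw [Real.dist_eq, e, abs_neg, abs_mul]
    have hterm : ∀ j ∈ Finset.univ,
        |Real.sin (x i - x j) - Real.sin (y i - y j)| ≤ 2 * dist x y := by
      intro j _
      have h1 := Real.lipschitzWith_sin.dist_le_mul (x i - x j) (y i - y j)
      simp only [Real.dist_eq, NNReal.coe_one, one_mul] at h1
      have h2 := dist_le_pi_dist x y i
      have h3 := dist_le_pi_dist x y j
      rw [Real.dist_eq] at h2 h3
      rw [abs_le] at h2 h3
      refine h1.trans (abs_le.mpr ⟨?_, ?_⟩) <;> linarith [h2.1, h2.2, h3.1, h3.2]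
    have hsum : |∑ j : Fin N, (Real.sin (x i - x j) - Real.sin (y i - y j))|
        ≤ N * (2 * dist x y) := by
      refine (Finset.abs_sum_le_sum_abs _ _).trans ((Finset.sum_le_card_nsmul _ _ _ hterm).trans ?_)
      simp
    calc _ ≤ |γ / (N : ℝ)| * (N * (2 * dist x y)) := by gcongr
      _ = _ := by rw [hcard i]; ring
  have hbd : ∀ x, ‖v x‖ ≤ (Real.toNNReal (‖ω‖ + |γ|) : ℝ) := by
    intro x
    rw [Real.coe_toNNReal _ (by positivity)]
    refine (pi_norm_le_iff_of_nonneg (by positivity)).mpr fun i => ?_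
    refine (norm_sub_le _ _).trans (add_le_add (norm_le_pi_norm ω i) ?_)
    rw [Real.norm_eq_abs, abs_mul]
    have hsum : |∑ j : Fin N, Real.sin (x i - x j)| ≤ N * 1 := by
      refine (Finset.abs_sum_le_sum_abs _ _).trans
        ((Finset.sum_le_card_nsmul _ _ 1 fun j _ => Real.abs_sin_le_one _).trans ?_)
      simp
    calc _ ≤ |γ / (N : ℝ)| * (N * 1) := by gcongr
      _ = _ := by rw [hcard i]; ring
  obtain ⟨θ, h0, hθ⟩ := exists_integralCurve_Ici hlip hbd x₀
  exact ⟨θ, h0, fun t ht i => hasDerivWithinAt_pi.mp (hθ t ht) i⟩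

/-! ### Distances on the circle and lifts of phases -/

theorem phaseDist_nonneg (x y : ℝ) : 0 ≤ phaseDist x y := abs_nonneg _

theorem phaseDist_le_pi (x y : ℝ) : phaseDist x y ≤ Real.pi := Real.Angle.abs_toReal_le_pi _

theorem phaseDist_eq_of_abs_lt {x y : ℝ} (h : |x - y| < Real.pi) : phaseDist x y = |x - y| := by
  rw [abs_lt] at h
  rw [phaseDist, Real.Angle.toReal_coe_eq_self_iff.mpr ⟨h.1, h.2.le⟩]

theorem phaseDist_eq_pi {x y : ℝ} {k : ℕ} (h : x - y = Real.pi + 2 * Real.pi * k) :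
    phaseDist x y = Real.pi := by
  have : ((x - y : ℝ) : Real.Angle) = (Real.pi : Real.Angle) := by
    rw [Real.Angle.angle_eq_iff_two_pi_dvd_sub]
    exact ⟨k, by rw [h]; push_cast; ring⟩
  rw [phaseDist, this, Real.Angle.toReal_pi, abs_of_pos Real.pi_pos]

theorem phaseDist_add_int_mul (x y : ℝ) (m n : ℤ) :
    phaseDist (x + 2 * Real.pi * m) (y + 2 * Real.pi * n) = phaseDist x y := by
  unfold phaseDist
  congr 2
  rw [Real.Angle.angle_eq_iff_two_pi_dvd_sub]
  exact ⟨m - n, by push_cast; ring⟩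

theorem exists_abs_add_int_mul_eq_phaseDist (x y : ℝ) :
    ∃ k : ℤ, |x + 2 * Real.pi * k - y| = phaseDist x y := by
  obtain ⟨k, hk⟩ := Real.Angle.angle_eq_iff_two_pi_dvd_sub.mp
    (Real.Angle.coe_toReal ((x - y : ℝ) : Real.Angle))
  refine ⟨k, ?_⟩
  rw [phaseDist]
  congr 1
  linarith

theorem IsSolution.hasDerivWithinAt_sub {γ : ℝ} {ω : Fin N → ℝ} {θ : ℝ → Fin N → ℝ}
    (hθ : IsSolution γ ω θ) {t : ℝ} (ht : 0 ≤ t) (i j : Fin N) :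
    HasDerivWithinAt (fun s => θ s i - θ s j)
      (ω i - ω j - γ / (N : ℝ) *
        ∑ k : Fin N, (Real.sin (θ t i - θ t k) - Real.sin (θ t j - θ t k))) (Set.Ici 0) t := by
  refine ((hθ t ht i).sub (hθ t ht j)).congr_deriv ?_
  rw [Finset.sum_sub_distrib]
  ring

theorem IsSolution.continuousOn_sub {γ : ℝ} {ω : Fin N → ℝ} {θ : ℝ → Fin N → ℝ}
    (hθ : IsSolution γ ω θ) (i j : Fin N) :
    ContinuousOn (fun s => θ s i - θ s j) (Set.Ici 0) :=
  fun _ ht => (hθ.hasDerivWithinAt_sub ht i j).continuousWithinAt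

/-- Shifting the phases by multiples of `2π` gives another solution. -/
theorem IsSolution.add_int_mul {γ : ℝ} {ω : Fin N → ℝ} {θ : ℝ → Fin N → ℝ}
    (hθ : IsSolution γ ω θ) (n : Fin N → ℤ) :
    IsSolution γ ω fun t i => θ t i + 2 * Real.pi * n i := by
  intro t ht i
  refine ((hθ t ht i).add_const _).congr_deriv ?_
  congr 2
  refine Finset.sum_congr rfl fun j _ => ?_
  rw [show θ t i + 2 * Real.pi * n i - (θ t j + 2 * Real.pi * n j)
    = θ t i - θ t j + ((n i - n j : ℤ) : ℝ) * (2 * Real.pi) by push_cast; ring,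
    Real.sin_add_int_mul_two_pi]

/-! ### Invariant regions -/

/-- Attraction between the extreme oscillators of `S`, when `S` has phase diameter `r`. -/
theorem le_sum_sin_sub_sin {S : Finset (Fin N)} {r : ℝ} (hr0 : 0 ≤ r) (hr : r ≤ Real.pi)
    {x : Fin N → ℝ} {i j : Fin N} (hij : x i - x j = r)
    (hi : ∀ k ∈ S, x i - x k ≤ r) (hj : ∀ k ∈ S, x k - x j ≤ r) :
    2 * Real.sin (r / 2) * (S.card * Real.cos (r / 2) - (N - S.card)) ≤
      ∑ k : Fin N, (Real.sin (x i - x k) - Real.sin (x j - x k)) := by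
  classical
  have hs : 0 ≤ Real.sin (r / 2) :=
    Real.sin_nonneg_of_nonneg_of_le_pi (by linarith) (by linarith)
  have hterm : ∀ k ∈ Finset.univ,
      2 * Real.sin (r / 2) * ((if k ∈ S then Real.cos (r / 2) + 1 else 0) - 1) ≤
        Real.sin (x i - x k) - Real.sin (x j - x k) := by
    intro k _
    -- The remaining cosine is that of the offset of `x k` from the midpoint of `x i` and `x j`,
    -- which is at most `r / 2` in absolute value for `k ∈ S`.
    rw [Real.sin_sub_sin, show (x i - x k - (x j - x k)) / 2 = r / 2 by linarith]
    refine mul_le_mul_of_nonneg_left ?_ (by positivity)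
    split_ifs with hk
    · rw [add_sub_cancel_right, ← Real.cos_abs ((x i - x k + (x j - x k)) / 2)]
      refine Real.cos_le_cos_of_nonneg_of_le_pi (abs_nonneg _) (by linarith) (abs_le.mpr ?_)
      constructor <;> linarith [hi k hk, hj k hk]
    · simpa using Real.neg_one_le_cos _
  refine le_trans (le_of_eq ?_) (Finset.sum_le_sum hterm)
  rw [← Finset.mul_sum, Finset.sum_sub_distrib, Finset.sum_ite_mem]
  simp
  ring_nf
  simp

/-- The phases of `S` stay within `r` of one another. -/
theorem IsSolution.sub_lt {γ : ℝ} (hγ : 0 ≤ γ) {ω : Fin N → ℝ} {θ : ℝ → Fin N → ℝ}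
    (hθ : IsSolution γ ω θ) {S : Finset (Fin N)} {r : ℝ} (hr0 : 0 ≤ r) (hr : r ≤ Real.pi)
    (hS : ∀ i ∈ S, ∀ j ∈ S, ω i - ω j < γ / (N : ℝ) *
      (2 * Real.sin (r / 2) * (S.card * Real.cos (r / 2) - (N - S.card))))
    (h0 : ∀ i ∈ S, ∀ j ∈ S, θ 0 i - θ 0 j < r) :
    ∀ t, 0 ≤ t → ∀ i ∈ S, ∀ j ∈ S, θ t i - θ t j < r := by
  by_contra! hcon
  set B : Set ℝ := ⋃ i ∈ S, ⋃ j ∈ S, Set.Ici 0 ∩ (fun s => θ s i - θ s j) ⁻¹' Set.Ici r with hB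
  have hmem : ∀ t, t ∈ B ↔ 0 ≤ t ∧ ∃ i ∈ S, ∃ j ∈ S, r ≤ θ t i - θ t j := by
    intro t
    simp only [hB, Set.mem_iUnion, Set.mem_inter_iff, Set.mem_preimage, Set.mem_Ici, exists_prop]
    constructor
    · rintro ⟨i, hi, j, hj, h, h'⟩; exact ⟨h, i, hi, j, hj, h'⟩
    · rintro ⟨h, i, hi, j, hj, h'⟩; exact ⟨i, hi, j, hj, h, h'⟩
  have hclosed : IsClosed B :=
    isClosed_biUnion_finset fun i _ => isClosed_biUnion_finset fun j _ =>
      (hθ.continuousOn_sub i j).preimage_isClosed_of_isClosed isClosed_Ici isClosed_Ici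
  have hbdd : BddBelow B := ⟨0, fun t ht => ((hmem t).mp ht).1⟩
  obtain ⟨t₀, ht₀, i₀, hi₀, j₀, hj₀, hr₀⟩ := hcon
  have hne : B.Nonempty := ⟨t₀, (hmem t₀).mpr ⟨ht₀, i₀, hi₀, j₀, hj₀, hr₀⟩⟩
  -- `τ` is the first time at which some pair of `S` reaches distance `r`; it is attained because
  -- `B` is closed.
  set τ := sInf B with hτ
  obtain ⟨hτ0, i, hi, j, hj, hij⟩ := (hmem τ).mp (hclosed.csInf_mem hne hbdd)
  have hτpos : 0 < τ := by
    refine hτ0.lt_of_ne fun h => ?_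
    rw [← h] at hij
    exact absurd (h0 i hi j hj) (not_lt.mpr hij)
  have hbefore : ∀ t ∈ Set.Ioo 0 τ, ∀ k ∈ S, ∀ l ∈ S, θ t k - θ t l < r := by
    intro t ht k hk l hl
    by_contra! h
    exact absurd (csInf_le hbdd ((hmem t).mpr ⟨ht.1.le, k, hk, l, hl, h⟩)) (not_le.mpr ht.2)
  have hderiv : ∀ k l, HasDerivAt (fun s => θ s k - θ s l) _ τ := fun k l =>
    (hθ.hasDerivWithinAt_sub hτ0 k l).hasDerivAt (Ici_mem_nhds hτpos)
  have hleft : Set.Ioo 0 τ ∈ 𝓝[<] τ := Ioo_mem_nhdsLT hτpos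
  have hle : ∀ k ∈ S, ∀ l ∈ S, θ τ k - θ τ l ≤ r := by
    intro k hk l hl
    refine le_of_tendsto ((hderiv k l).continuousAt.tendsto.mono_left
      (nhdsWithin_le_nhds (s := Set.Iio τ))) ?_
    filter_upwards [hleft] with t ht using (hbefore t ht k hk l hl).le
  have hsl := (hasDerivWithinAt_iff_tendsto_slope' (s := Set.Iio τ) Set.self_notMem_Iio).mp
    ((hderiv i j).hasDerivWithinAt (s := Set.Iio τ))
  -- The difference climbs to `r` from below, so its left slopes at `τ` are nonnegative; `hS` and
  -- the attraction make the derivative negative.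
  have hnn := ge_of_tendsto (b := (0 : ℝ)) hsl (by
    filter_upwards [hleft] with t ht
    rw [slope_def_field]
    refine div_nonneg_of_nonpos ?_ (by linarith [ht.2])
    linarith [hbefore t ht i hi j hj])
  have hsum := le_sum_sin_sub_sin (S := S) (x := θ τ) hr0 hr
    (le_antisymm (hle i hi j hj) hij) (fun k hk => hle i hi k hk) (fun k hk => hle k hk j hj)
  have hmul := mul_le_mul_of_nonneg_left hsum (show 0 ≤ γ / (N : ℝ) by positivity)
  linarith [hS i hi j hj]

/-- Transfers `IsSolution.sub_lt` from the line to the circle. The condition `3 * r ≤ 2 * π` is what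
lets pairwise close phases be lifted simultaneously: with a larger `r` they could be spread around
the whole circle. -/
theorem isInvariantRegion_of_sub_lt {γ : ℝ} (hγ : 0 ≤ γ) {ω : Fin N → ℝ}
    {S : Finset (Fin N)} {r : ℝ} (hr0 : 0 ≤ r) (hr : 3 * r ≤ 2 * Real.pi)
    (hS : ∀ i ∈ S, ∀ j ∈ S, ω i - ω j < γ / (N : ℝ) *
      (2 * Real.sin (r / 2) * (S.card * Real.cos (r / 2) - (N - S.card)))) :
    IsInvariantRegion γ ω r S := by
  intro θ hθ h0 t ht i hi j hj
  have hpi := Real.pi_pos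
  choose n hn using fun k => exists_abs_add_int_mul_eq_phaseDist (θ 0 k) (θ 0 i)
  have hψ := hθ.add_int_mul n
  have hnear : ∀ k ∈ S, |θ 0 k + 2 * Real.pi * n k - θ 0 i| < r := fun k hk =>
    (hn k).trans_lt (h0 k hk i hi)
  have hlift : ∀ k ∈ S, ∀ l ∈ S,
      θ 0 k + 2 * Real.pi * n k - (θ 0 l + 2 * Real.pi * n l) < r := by
    intro k hk l hl
    have h1 := abs_lt.mp (hnear k hk)
    have h2 := abs_lt.mp (hnear l hl)
    have h3 := h0 k hk l hl
    obtain ⟨m, hm⟩ := exists_abs_add_int_mul_eq_phaseDist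
      (θ 0 k + 2 * Real.pi * n k) (θ 0 l + 2 * Real.pi * n l)
    rw [phaseDist_add_int_mul] at hm
    rw [← hm, abs_lt] at h3
    -- Both lifts are within `r` of `θ 0 i`, hence within `2r` of each other, and a shift by `2πm`
    -- brings them within `r`; so `2π|m| < 3r ≤ 2π`.
    have hm0 : m = 0 := by
      have a1 : (m : ℝ) < 1 := by
        by_contra! h
        have := mul_le_mul_of_nonneg_left h (show 0 ≤ 2 * Real.pi by positivity)
        linarith [h3.2]
      have a2 : (-1 : ℝ) < m := by
        by_contra! h
        have := mul_le_mul_of_nonneg_left h (show 0 ≤ 2 * Real.pi by positivity)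
        linarith [h3.1]
      have b1 : m < 1 := by exact_mod_cast a1
      have b2 : -1 < m := by exact_mod_cast a2
      omega
    rw [hm0] at h3
    simpa using h3.2
  have key := hψ.sub_lt hγ hr0 (by linarith) hS hlift t ht
  have habs : |θ t i + 2 * Real.pi * n i - (θ t j + 2 * Real.pi * n j)| < r :=
    abs_lt.mpr ⟨by linarith [key j hj i hi], key i hi j hj⟩
  rw [← phaseDist_add_int_mul _ _ (n i) (n j), phaseDist_eq_of_abs_lt (by linarith)]
  exact habs

/-- The solution started with all phases equal begins in the region and never leaves it. -/
theorem IsInvariantRegion.isEntrained {γ : ℝ} {ω : Fin N → ℝ} {S : Finset (Fin N)} {r c : ℝ}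
    (hr : 0 < r) (hrc : r ≤ c) (h : IsInvariantRegion γ ω r S) : IsEntrained γ ω c S := by
  obtain ⟨θ, h0, hθ⟩ := exists_isSolution γ ω 0
  refine ⟨θ, hθ, fun i hi j hj => ?_⟩
  have hlt := h θ hθ (fun k _ l _ => by rw [h0]; simpa [phaseDist] using hr)
  refine limsup_le_of_le (isCoboundedUnder_le_of_le atTop (x := 0) fun t => phaseDist_nonneg _ _) ?_
  filter_upwards [eventually_ge_atTop 0] with t ht
  exact (hlt t ht i hi j hj).le.trans hrc

/-! ### Frequency spread of an entrained cluster -/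

/-- The natural frequencies of an entrained cluster lie within `2γ` of one another. -/
theorem IsEntrained.sub_le {γ : ℝ} (hγ : 0 ≤ γ) {ω : Fin N → ℝ} {c : ℝ} (hc : c < Real.pi)
    {S : Finset (Fin N)} (h : IsEntrained γ ω c S) {i j : Fin N} (hi : i ∈ S) (hj : j ∈ S) :
    ω i - ω j ≤ 2 * γ := by
  by_contra! hlt
  obtain ⟨θ, hθ, hlim⟩ := h
  have hN : (0 : ℝ) < N := by exact_mod_cast i.pos
  set κ := ω i - ω j - 2 * γ with hκ
  have hκ0 : 0 < κ := by linarith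
  have hcont := hθ.continuousOn_sub i j
  have hsum : ∀ t, γ / (N : ℝ) *
      ∑ k : Fin N, (Real.sin (θ t i - θ t k) - Real.sin (θ t j - θ t k)) ≤ 2 * γ := by
    intro t
    have h1 : ∑ k : Fin N, (Real.sin (θ t i - θ t k) - Real.sin (θ t j - θ t k)) ≤ N * 2 := by
      refine (Finset.sum_le_card_nsmul _ _ 2 fun k _ => ?_).trans (by simp)
      linarith [Real.sin_le_one (θ t i - θ t k), Real.neg_one_le_sin (θ t j - θ t k)]
    calc _ ≤ γ / (N : ℝ) * (N * 2) := by gcongr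
      _ = 2 * γ := by field_simp
  -- The difference grows at rate at least `κ`, the excess of the frequency gap over `2γ`.
  have hmono : MonotoneOn (fun t => θ t i - θ t j - κ * t) (Set.Ici 0) := by
    refine monotoneOn_of_hasDerivWithinAt_nonneg (convex_Ici 0)
      (f' := fun t => ω i - ω j - γ / (N : ℝ) *
        ∑ k : Fin N, (Real.sin (θ t i - θ t k) - Real.sin (θ t j - θ t k)) - κ)
      (hcont.sub (by fun_prop)) (fun t ht => ?_) (fun t _ => ?_)
    · rw [interior_Ici] at ht ⊢
      have := (hθ.hasDerivWithinAt_sub (le_of_lt ht) i j).mono Set.Ioi_subset_Ici_self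
      exact (this.sub ((hasDerivWithinAt_id t _).const_mul κ)).congr_deriv (by ring)
    · have := hsum t
      linarith
  have hgrow : ∀ t, 0 ≤ t → θ 0 i - θ 0 j + κ * t ≤ θ t i - θ t j := by
    intro t ht
    have := hmono (Set.self_mem_Ici) (show t ∈ Set.Ici 0 from ht) ht
    simp only at this
    linarith
  have hfreq : ∃ᶠ t in atTop, Real.pi ≤ phaseDist (θ t i) (θ t j) := by
    refine frequently_atTop.mpr fun T => ?_
    set T' := max T 0 with hT'
    -- `k` puts the target `π + 2πk` above the current difference; `n` is a waiting time that
    -- suffices to pass it.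
    obtain ⟨k, hk⟩ := exists_nat_ge ((θ T' i - θ T' j) / (2 * Real.pi))
    rw [div_le_iff₀ (by positivity)] at hk
    obtain ⟨n, hn⟩ := exists_nat_ge ((Real.pi + 2 * Real.pi * k - (θ 0 i - θ 0 j)) / κ)
    rw [div_le_iff₀ hκ0] at hn
    have hT0 : 0 ≤ T' := le_max_right _ _
    have hnn : (0 : ℝ) ≤ n := n.cast_nonneg
    have hg := hgrow (T' + n) (by positivity)
    have hκT : 0 ≤ κ * T' := by positivity
    obtain ⟨t, ht, e⟩ := intermediate_value_Icc (show T' ≤ T' + n by linarith)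
      (hcont.mono fun s hs => hT0.trans hs.1)
      (show Real.pi + 2 * Real.pi * k ∈ Set.Icc (θ T' i - θ T' j)
          (θ (T' + n) i - θ (T' + n) j) from
        ⟨by linarith [Real.pi_pos], by linarith⟩)
    exact ⟨t, (le_max_left T 0).trans ht.1, (phaseDist_eq_pi e).ge⟩
  have := le_limsup_of_frequently_le hfreq
    (isBoundedUnder_of ⟨Real.pi, fun t => phaseDist_le_pi _ _⟩)
  linarith [hlim i hi j hj]

theorem bddAbove_card_entrained (γ : ℝ) (ω : Fin N → ℝ) (c : ℝ) :
    BddAbove {n : ℕ | ∃ S : Finset (Fin N), IsEntrained γ ω c S ∧ S.card = n} := by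
  refine ⟨N, ?_⟩
  rintro _ ⟨S, -, rfl⟩
  simpa using S.card_le_univ

theorem IsEntrained.card_le_clusterSize {γ : ℝ} {ω : Fin N → ℝ} {c : ℝ} {S : Finset (Fin N)}
    (h : IsEntrained γ ω c S) : S.card ≤ clusterSize γ ω c :=
  le_csSup (bddAbove_card_entrained γ ω c) ⟨S, h, rfl⟩

/-- A cluster fits into a window of natural frequencies of length `2γ`. -/
theorem exists_clusterSize_le_card {γ : ℝ} (hγ : 0 ≤ γ) (ω : Fin N → ℝ) {c : ℝ}
    (hc : c < Real.pi) :
    ∃ a : ℝ, clusterSize γ ω c ≤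
      (Finset.univ.filter fun i => ω i ∈ Set.Icc a (a + 2 * γ)).card := by
  rcases Set.eq_empty_or_nonempty
    {n : ℕ | ∃ S : Finset (Fin N), IsEntrained γ ω c S ∧ S.card = n} with he | hne
  -- The empty cluster is always entrained, so this case is void; `sSup ∅ = 0` closes it anyway.
  · exact ⟨0, by simp [clusterSize, he]⟩
  obtain ⟨S, hS, hcard⟩ := Nat.sSup_mem hne (bddAbove_card_entrained γ ω c)
  rw [clusterSize, ← hcard]
  rcases S.eq_empty_or_nonempty with rfl | hSne
  · exact ⟨0, by simp⟩
  obtain ⟨j, hj, hmin⟩ := S.exists_min_image ω hSne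
  refine ⟨ω j, Finset.card_le_card fun i hi => ?_⟩
  simp only [Finset.mem_filter, Finset.mem_univ, true_and, Set.mem_Icc]
  exact ⟨hmin i hi, by linarith [hS.sub_le hγ hc hi hj]⟩

/-! ### Concentration of frequency counts -/

theorem WithHighProbability.mono {f : ℝ → ℝ} {E F : (N : ℕ) → (Fin N → ℝ) → Prop}
    (h : WithHighProbability f E) (hEF : ∀ᶠ N in atTop, ∀ ω, E N ω → F N ω) :
    WithHighProbability f F := by
  refine tendsto_of_tendsto_of_tendsto_of_le_of_le' tendsto_const_nhds h
    (Eventually.of_forall fun _ => zero_le) ?_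
  filter_upwards [hEF] with N hN
  exact measure_mono fun ω hω h' => hω (hN ω h')

theorem WithHighProbability.and {f : ℝ → ℝ} {E F : (N : ℕ) → (Fin N → ℝ) → Prop}
    (hE : WithHighProbability f E) (hF : WithHighProbability f F) :
    WithHighProbability f fun N ω => E N ω ∧ F N ω := by
  have := hE.add hF
  rw [add_zero] at this
  refine tendsto_of_tendsto_of_tendsto_of_le_of_le tendsto_const_nhds this
    (fun _ => zero_le) fun N => ?_
  refine (measure_mono fun ω hω => ?_).trans (measure_union_le _ _)
  exact not_and_or.mp hω

/-- The law of a single frequency. -/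
noncomputable def singleLaw (f : ℝ → ℝ) : Measure ℝ := volume.withDensity fun x => ENNReal.ofReal (f x)

/-- The number of frequencies that lie in `A`. -/
noncomputable def countIn {N : ℕ} (ω : Fin N → ℝ) (A : Set ℝ) : ℕ := {i | ω i ∈ A}.ncard

theorem countIn_mono {N : ℕ} (ω : Fin N → ℝ) {A B : Set ℝ} (h : A ⊆ B) :
    countIn ω A ≤ countIn ω B := Set.ncard_le_ncard (fun _ hi => h hi) (Set.toFinite _)

theorem countIn_add_compl {N : ℕ} (ω : Fin N → ℝ) (A : Set ℝ) :
    countIn ω A + countIn ω Aᶜ = N := by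
  have := Set.ncard_add_ncard_compl {i | ω i ∈ A}
  rwa [Nat.card_eq_fintype_card, Fintype.card_fin] at this

theorem countIn_eq_sum {N : ℕ} (ω : Fin N → ℝ) (A : Set ℝ) :
    (countIn ω A : ℝ) = ∑ i, A.indicator (fun _ => (1 : ℝ)) (ω i) := by
  classical
  rw [countIn, Set.ncard_eq_toFinset_card']
  simp [Set.indicator_apply]

theorem IsSymmUnimodalDensity.isProbabilityMeasure {f : ℝ → ℝ}
    (hf : IsSymmUnimodalDensity f) : IsProbabilityMeasure (singleLaw f) := by
  constructor
  rw [singleLaw, withDensity_apply _ MeasurableSet.univ, Measure.restrict_univ,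
    ← ofReal_integral_eq_lintegral_ofReal hf.integrable (ae_of_all _ hf.nonneg),
    hf.integral_eq_one, ENNReal.ofReal_one]

theorem IsSymmUnimodalDensity.real_singleLaw {f : ℝ → ℝ}
    (hf : IsSymmUnimodalDensity f) {A : Set ℝ} (hA : MeasurableSet A) :
    (singleLaw f).real A = ∫ x in A, f x := by
  rw [measureReal_def, singleLaw, withDensity_apply _ hA,
    ← ofReal_integral_eq_lintegral_ofReal hf.integrable.integrableOn
      (ae_of_all _ hf.nonneg), ENNReal.toReal_ofReal (integral_nonneg hf.nonneg)]

/-- **Hoeffding's inequality** for the number of frequencies in `A`. -/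
theorem IsSymmUnimodalDensity.measure_countIn_ge {f : ℝ → ℝ}
    (hf : IsSymmUnimodalDensity f) {A : Set ℝ} (hA : MeasurableSet A) (N : ℕ)
    {t : ℝ} (ht : 0 ≤ t) :
    freqLaw f N {ω | N * (singleLaw f).real A + t ≤ countIn ω A} ≤
      ENNReal.ofReal (Real.exp (-2 * t ^ 2 / N)) := by
  have := hf.isProbabilityMeasure
  have hlaw : freqLaw f N = Measure.pi fun _ : Fin N => singleLaw f := rfl
  have : IsProbabilityMeasure (freqLaw f N) := by rw [hlaw]; infer_instance
  set p := (singleLaw f).real A with hp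
  set Y : ℝ → ℝ := A.indicator fun _ => 1 with hY
  have hYm : Measurable Y := measurable_const.indicator hA
  have hint : ∀ i : Fin N, ∫ ω, Y (ω i) ∂freqLaw f N = p := by
    intro i
    have e := integral_comp_eval (μ := fun _ : Fin N => singleLaw f) (i := i) (f := Y)
      hYm.aestronglyMeasurable
    rw [hY, integral_indicator_const _ hA, ← hY, ← hp, smul_eq_mul, mul_one] at e
    exact e
  have hind : ProbabilityTheory.iIndepFun (fun (i : Fin N) ω => Y (ω i) - p) (freqLaw f N) :=
    ProbabilityTheory.iIndepFun_pi (μ := fun _ : Fin N => singleLaw f)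
      (X := fun (_ : Fin N) x => Y x - p)
      fun _ => (hYm.sub_const p).aemeasurable
  -- Hoeffding's lemma: a centred variable with values in an interval of length `1` has variance
  -- proxy `1/4`. The sum has `N/4`, whence the exponent `-2 t² / N`.
  have hsub : ∀ i ∈ Finset.univ, ProbabilityTheory.HasSubgaussianMGF
      (fun ω : Fin N → ℝ => Y (ω i) - p) ((‖(1 : ℝ) - 0‖₊ / 2) ^ 2) (freqLaw f N) := by
    intro i _
    have := ProbabilityTheory.hasSubgaussianMGF_of_mem_Icc (μ := freqLaw f N)
      (X := fun ω => Y (ω i)) (a := 0) (b := 1)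
      (hYm.comp (measurable_pi_apply i)).aemeasurable
      (ae_of_all _ fun ω => by
        by_cases h : ω i ∈ A <;> simp [hY, h])
    rwa [hint i] at this
  have key := ProbabilityTheory.HasSubgaussianMGF.measure_sum_ge_le_of_iIndepFun hind hsub ht
  rw [← ENNReal.ofReal_toReal (measure_ne_top (freqLaw f N) _)]
  refine ENNReal.ofReal_le_ofReal (le_trans (le_of_eq ?_) (key.trans (le_of_eq ?_)))
  · rw [measureReal_def]
    congr 2
    ext ω
    rw [Set.mem_ofPred_eq, Set.mem_ofPred_eq, countIn_eq_sum, Finset.sum_sub_distrib]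
    simp only [Finset.sum_const, Finset.card_univ, Fintype.card_fin, nsmul_eq_mul, ← hY]
    constructor <;> intro h <;> linarith
  · congr 1
    rcases Nat.eq_zero_or_pos N with rfl | hN
    · simp
    · have : (0 : ℝ) < N := by exact_mod_cast hN
      simp
      field_simp

/-- Union bound: no set of a polynomially large family of sets of probability at most `p N`
contains many more than `N * p N` frequencies. -/
theorem IsSymmUnimodalDensity.whp_forall_countIn_lt {f : ℝ → ℝ}
    (hf : IsSymmUnimodalDensity f) {ι : Type*} (s : ℕ → Finset ι)
    (A : ℕ → ι → Set ℝ) (p : ℕ → ℝ) (K : ℝ) (hs : ∀ N, ((s N).card : ℝ) ≤ K * (N + 1) ^ 2)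
    (hA : ∀ N i, MeasurableSet (A N i))
    (hp : ∀ᶠ N in atTop, ∀ i ∈ s N, (singleLaw f).real (A N i) ≤ p N)
    {ε : ℝ} (hε : 0 < ε) :
    WithHighProbability f fun N ω =>
      ∀ i ∈ s N, (countIn ω (A N i) : ℝ) < N * p N + (N : ℝ) ^ (1 / 2 + ε) := by
  have hlim : Tendsto (fun N : ℕ => ENNReal.ofReal
      (K * ((N : ℝ) + 1) ^ 2 * Real.exp (-2 * (N : ℝ) ^ (2 * ε)))) atTop (𝓝 0) := by
    rw [← ENNReal.ofReal_zero]
    refine ENNReal.tendsto_ofReal ?_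
    -- The exponent turns `x = N ^ (2ε)` into `x ^ (2 / (2ε)) = N ^ 2`, the size of the family.
    have h1 : Tendsto (fun x : ℝ => x ^ (2 / (2 * ε)) * Real.exp (-2 * x)) atTop (𝓝 0) :=
      tendsto_rpow_mul_exp_neg_mul_atTop_nhds_zero _ 2 (by norm_num)
    have h2 : Tendsto (fun N : ℕ => (N : ℝ) ^ (2 * ε)) atTop atTop :=
      (tendsto_rpow_atTop (by positivity)).comp tendsto_natCast_atTop_atTop
    have h3 := (h1.comp h2).const_mul (|K| * 4)
    rw [mul_zero] at h3
    refine squeeze_zero_norm' ?_ h3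
    filter_upwards [eventually_ge_atTop 1] with N hN
    have hN' : (1 : ℝ) ≤ N := by exact_mod_cast hN
    simp only [Function.comp]
    rw [← Real.rpow_mul (by positivity), mul_div_cancel₀ _ (by positivity : 2 * ε ≠ 0),
      Real.norm_eq_abs, abs_mul, abs_mul, abs_of_nonneg (Real.exp_pos _).le,
      abs_of_nonneg (by positivity : 0 ≤ ((N : ℝ) + 1) ^ 2)]
    rw [Real.rpow_two]
    have : ((N : ℝ) + 1) ^ 2 ≤ 4 * (N : ℝ) ^ 2 := by nlinarith
    calc |K| * ((N : ℝ) + 1) ^ 2 * Real.exp (-2 * (N : ℝ) ^ (2 * ε))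
        ≤ |K| * (4 * (N : ℝ) ^ 2) * Real.exp (-2 * (N : ℝ) ^ (2 * ε)) := by gcongr
      _ = _ := by ring
  refine tendsto_of_tendsto_of_tendsto_of_le_of_le' tendsto_const_nhds hlim
    (Eventually.of_forall fun _ => zero_le) ?_
  filter_upwards [hp, eventually_ge_atTop 1] with N hN hN1
  have hN' : (0 : ℝ) < N := by exact_mod_cast hN1
  have hone : ∀ i ∈ s N, freqLaw f N {ω | N * p N + (N : ℝ) ^ (1 / 2 + ε) ≤ countIn ω (A N i)} ≤
      ENNReal.ofReal (Real.exp (-2 * (N : ℝ) ^ (2 * ε))) := by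
    intro i hi
    refine (measure_mono fun ω hω => ?_).trans ((hf.measure_countIn_ge (hA N i) N
      (t := (N : ℝ) ^ (1 / 2 + ε)) (by positivity)).trans (le_of_eq ?_))
    · have := mul_le_mul_of_nonneg_left (hN i hi) hN'.le
      simp only [Set.mem_ofPred_eq] at hω ⊢
      linarith
    · congr 2
      rw [← Real.rpow_natCast, ← Real.rpow_mul hN'.le, mul_div_assoc, ← Real.rpow_sub_one hN'.ne']
      congr 2
      push_cast
      ring
  have hsub : {ω : Fin N → ℝ | ¬ ∀ i ∈ s N,
      (countIn ω (A N i) : ℝ) < N * p N + (N : ℝ) ^ (1 / 2 + ε)} ⊆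
      ⋃ i ∈ s N, {ω | N * p N + (N : ℝ) ^ (1 / 2 + ε) ≤ countIn ω (A N i)} := by
    intro ω hω
    simp only [Set.mem_ofPred_eq, not_forall, not_lt] at hω
    obtain ⟨i, hi, h⟩ := hω
    exact Set.mem_biUnion hi h
  refine (measure_mono hsub).trans ((measure_biUnion_finset_le _ _).trans
    ((Finset.sum_le_sum hone).trans ?_))
  rw [Finset.sum_const, nsmul_eq_mul, ← ENNReal.ofReal_natCast,
    ← ENNReal.ofReal_mul (by positivity)]
  exact ENNReal.ofReal_le_ofReal (mul_le_mul_of_nonneg_right (hs N) (Real.exp_pos _).le)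

theorem IsSymmUnimodalDensity.whp_countIn_lt {f : ℝ → ℝ}
    (hf : IsSymmUnimodalDensity f) {A : Set ℝ} (hA : MeasurableSet A) {p : ℝ}
    (hp : (singleLaw f).real A ≤ p) {ε : ℝ} (hε : 0 < ε) :
    WithHighProbability f fun N ω => (countIn ω A : ℝ) < N * p + (N : ℝ) ^ (1 / 2 + ε) := by
  refine (hf.whp_forall_countIn_lt (fun _ => {()}) (fun _ _ => A) (fun _ => p) 1
    (fun N => ?_) (fun _ _ => hA) (Eventually.of_forall fun _ _ _ => hp) hε).mono
    (Eventually.of_forall fun N ω h => h () (by simp))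
  have : (0 : ℝ) ≤ N := N.cast_nonneg
  simp only [Finset.card_singleton, Nat.cast_one, one_mul]
  nlinarith

/-- The number of frequencies in `A` is not much smaller than expected. -/
theorem IsSymmUnimodalDensity.whp_lt_countIn {f : ℝ → ℝ}
    (hf : IsSymmUnimodalDensity f) {A : Set ℝ} (hA : MeasurableSet A)
    {ε : ℝ} (hε : 0 < ε) :
    WithHighProbability f fun N ω =>
      (singleLaw f).real A * N - (N : ℝ) ^ (1 / 2 + ε) < countIn ω A := by
  have := hf.isProbabilityMeasure
  -- A lower bound for the count in `A` is an upper bound for the count in its complement.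
  refine (hf.whp_countIn_lt hA.compl le_rfl hε).mono (Eventually.of_forall fun N ω h => ?_)
  rw [probReal_compl_eq_one_sub hA] at h
  have e : (countIn ω A : ℝ) + countIn ω Aᶜ = N := by exact_mod_cast countIn_add_compl ω A
  linarith

/-! ### Windows of frequencies -/

theorem IsSymmUnimodalDensity.le_of_abs_le {f : ℝ → ℝ}
    (hf : IsSymmUnimodalDensity f) {x y : ℝ} (h : |x| ≤ |y|) : f y ≤ f x := by
  have habs : ∀ z, f |z| = f z := by
    intro z
    rcases abs_choice z with hz | hz <;> rw [hz]
    exact hf.symmetric z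
  rw [← habs x, ← habs y]
  rcases (abs_nonneg x).lt_or_eq with h0 | h0
  · exact hf.decreasing h0 (h0.trans_le h) h
  -- Monotonicity is assumed on the open half-line only, so the point `0` needs `max_at_zero`.
  · rw [← h0]; exact hf.max_at_zero _

/-- Among the intervals of a given length the one centred at `0` has the largest probability. -/
theorem IsSymmUnimodalDensity.setIntegral_Icc_le {f : ℝ → ℝ}
    (hf : IsSymmUnimodalDensity f) (a : ℝ) {b : ℝ} (hb : 0 ≤ b) :
    ∫ x in Set.Icc a (a + 2 * b), f x ≤ ∫ x in Set.Icc (-b) b, f x := by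
  set A := Set.Icc a (a + 2 * b) with hA
  set B := Set.Icc (-b) b with hB
  have hAm : MeasurableSet A := measurableSet_Icc
  have hBm : MeasurableSet B := measurableSet_Icc
  have hAfin : volume A ≠ ⊤ := measure_Icc_lt_top.ne
  have hBfin : volume B ≠ ⊤ := measure_Icc_lt_top.ne
  have hiA : IntegrableOn (fun x => f x - f b) A :=
    hf.integrable.integrableOn.sub (integrableOn_const hAfin)
  have hiB : IntegrableOn (fun x => f x - f b) B :=
    hf.integrable.integrableOn.sub (integrableOn_const hBfin)
  have hnn : ∀ x ∈ B, 0 ≤ f x - f b := fun x hx =>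
    sub_nonneg.mpr (hf.le_of_abs_le (by rw [abs_of_nonneg hb]; exact abs_le.mpr hx))
  have hnp : ∀ x ∉ B, f x - f b ≤ 0 := fun x hx =>
    sub_nonpos.mpr (hf.le_of_abs_le (by
      rw [abs_of_nonneg hb]
      by_contra! h
      exact hx (abs_le.mp h.le)))
  -- Bathtub argument: `f - f b` is nonnegative on `B` and nonpositive off it, so `B` maximises its
  -- integral. The subtracted constants cancel because `A` and `B` have equal length.
  have key : ∫ x in A, (f x - f b) ≤ ∫ x in B, (f x - f b) := by
    rw [← integral_indicator hAm, ← integral_indicator hBm]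
    refine integral_mono (hiA.integrable_indicator hAm) (hiB.integrable_indicator hBm) fun x => ?_
    by_cases h1 : x ∈ A <;> by_cases h2 : x ∈ B <;> simp only [Set.indicator_of_mem,
      Set.indicator_of_notMem, h1, h2, not_false_eq_true, le_refl]
    · exact hnp x h2
    · exact hnn x h2
  rw [integral_sub hf.integrable.integrableOn (integrableOn_const hAfin),
    integral_sub hf.integrable.integrableOn (integrableOn_const hBfin)] at key
  have e : volume.real A = volume.real B := by
    simp only [hA, hB, Real.volume_real_Icc]
    congr 1
    ring
  simp only [setIntegral_const, e] at key
  linarith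

/-- The cost of widening a window to fit a grid: the added length `2 * δ` is weighted by the maximum
`f 0`. -/
theorem IsSymmUnimodalDensity.setIntegral_Icc_neg_add_le {f : ℝ → ℝ}
    (hf : IsSymmUnimodalDensity f) {b δ : ℝ} (hb : 0 ≤ b) (hδ : 0 ≤ δ) :
    ∫ x in Set.Icc (-(b + δ)) (b + δ), f x ≤ (∫ x in (-b)..b, f x) + 2 * δ * f 0 := by
  have hii : ∀ a b : ℝ, IntervalIntegrable f volume a b :=
    fun a b => hf.integrable.intervalIntegrable
  have bound : ∀ x y : ℝ, x ≤ y → ∫ w in x..y, f w ≤ (y - x) * f 0 := by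
    intro x y hxy
    have := intervalIntegral.integral_mono hxy (hii x y) (by simp) hf.max_at_zero
    simpa using this
  rw [integral_Icc_eq_integral_Ioc, ← intervalIntegral.integral_of_le (by linarith),
    ← intervalIntegral.integral_add_adjacent_intervals (hii _ (-b)) (hii _ _),
    ← intervalIntegral.integral_add_adjacent_intervals (hii (-b) b) (hii _ _)]
  have h1 := bound (-(b + δ)) (-b) (by linarith)
  have h2 := bound b (b + δ) (by linarith)
  linarith

/-- No window of length `2γ` contains many more frequencies than the one centred at `0`. -/
theorem IsSymmUnimodalDensity.whp_forall_window {f : ℝ → ℝ}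
    (hf : IsSymmUnimodalDensity f) {γ : ℝ} (hγ : 0 < γ) {ε : ℝ} (hε : 0 < ε) :
    WithHighProbability f fun N ω => ∀ a : ℝ, (countIn ω (Set.Icc a (a + 2 * γ)) : ℝ) ≤
      N * (∫ x in (-γ)..γ, f x) + (f 0 + 1) * (N : ℝ) ^ (1 / 2 + ε) := by
  have := hf.isProbabilityMeasure
  set p := ∫ x in (-γ)..γ, f x with hp
  have hp0 : 0 < p := intervalIntegral.intervalIntegral_pos_of_pos
    hf.integrable.intervalIntegrable hf.pos (by linarith)
  have htop : Tendsto (fun x : ℝ => (singleLaw f).real (Set.Ici x)) atTop (𝓝 0) := by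
    have h := tendsto_measure_iInter_atTop (μ := singleLaw f) (s := fun x : ℝ => Set.Ici x)
      (fun x => measurableSet_Ici.nullMeasurableSet) (fun x y h => Set.Ici_subset_Ici.mpr h)
      ⟨0, measure_ne_top _ _⟩
    have e : ⋂ x : ℝ, Set.Ici x = ∅ := by
      refine Set.eq_empty_of_forall_notMem fun y hy => ?_
      exact absurd (Set.mem_iInter.mp hy (y + 1)) (by simp)
    rw [e, measure_empty] at h
    exact (ENNReal.tendsto_toReal ENNReal.zero_ne_top).comp h
  have hbot : Tendsto (fun x : ℝ => (singleLaw f).real (Set.Iic x)) atBot (𝓝 0) := by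
    have h := tendsto_measure_iInter_atBot (μ := singleLaw f) (s := fun x : ℝ => Set.Iic x)
      (fun x => measurableSet_Iic.nullMeasurableSet) (fun x y h => Set.Iic_subset_Iic.mpr h)
      ⟨0, measure_ne_top _ _⟩
    have e : ⋂ x : ℝ, Set.Iic x = ∅ := by
      refine Set.eq_empty_of_forall_notMem fun y hy => ?_
      exact absurd (Set.mem_iInter.mp hy (y - 1)) (by simp)
    rw [e, measure_empty] at h
    exact (ENNReal.tendsto_toReal ENNReal.zero_ne_top).comp h
  -- Windows starting outside `(-R, R)` lie in one of two half-lines of mass at most `p`, which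
  -- leaves `O(N)` grid windows for the union bound.
  obtain ⟨R, hR1, hR2⟩ : ∃ R : ℕ, (singleLaw f).real (Set.Ici (R : ℝ)) ≤ p ∧
      (singleLaw f).real (Set.Iic (-(R : ℝ) + 2 * γ)) ≤ p := by
    have t1 := (htop.eventually (ge_mem_nhds hp0))
    have t2 : ∀ᶠ x : ℝ in atTop, (singleLaw f).real (Set.Iic (-x + 2 * γ)) ≤ p :=
      (tendsto_atBot_add_const_right _ (2 * γ) tendsto_neg_atTop_atBot).eventually
        (hbot.eventually (ge_mem_nhds hp0))
    exact (tendsto_natCast_atTop_atTop.eventually (t1.and t2)).exists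
  -- A window starting in `[k/N, (k+1)/N)` lies in `[k/N, (k+1)/N + 2γ]`, of mass at most `p + f 0 /
  -- N`. Over `N` frequencies the surplus is `f 0`, absorbed by the constant `f 0 + 1`.
  have hgrid := hf.whp_forall_countIn_lt
    (fun N => Finset.Icc (-(R * N : ℤ)) (R * N))
    (fun N k => Set.Icc (k / N : ℝ) (k / N + 2 * (γ + 1 / (2 * N))))
    (fun N => p + f 0 / N) (2 * R + 1) (fun N => ?_) (fun N k => measurableSet_Icc) ?_ hε
  · refine ((hgrid.and (hf.whp_countIn_lt measurableSet_Ici hR1 hε)).and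
      (hf.whp_countIn_lt measurableSet_Iic hR2 hε)).mono ?_
    filter_upwards [eventually_ge_atTop 1] with N hN ω ⟨⟨h1, h2⟩, h3⟩ a
    have hN' : (1 : ℝ) ≤ N := by exact_mod_cast hN
    have hN0 : (0 : ℝ) < N := by linarith
    have hpow : (1 : ℝ) ≤ (N : ℝ) ^ (1 / 2 + ε) := Real.one_le_rpow hN' (by positivity)
    have hf0 := hf.pos 0
    have hf0pow : f 0 * 1 ≤ f 0 * (N : ℝ) ^ (1 / 2 + ε) :=
      mul_le_mul_of_nonneg_left hpow hf0.le
    have mono : ∀ B : Set ℝ, Set.Icc a (a + 2 * γ) ⊆ B →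
        (countIn ω (Set.Icc a (a + 2 * γ)) : ℝ) ≤ countIn ω B := fun B hB => by
      exact_mod_cast countIn_mono ω hB
    by_cases ha1 : (R : ℝ) ≤ a
    · have := mono (Set.Ici (R : ℝ)) fun x hx => ha1.trans hx.1
      linarith
    by_cases ha2 : a ≤ -(R : ℝ)
    · have := mono (Set.Iic (-(R : ℝ) + 2 * γ)) fun x hx =>
        hx.2.trans (by linarith)
      linarith
    push Not at ha1 ha2
    have hfl := Int.floor_le (a * N)
    have hfl' := Int.lt_floor_add_one (a * N)
    have hk : ⌊a * N⌋ ∈ Finset.Icc (-(R * N : ℤ)) (R * N) := by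
      rw [Finset.mem_Icc]
      constructor
      · rw [Int.le_floor]
        push_cast
        nlinarith
      · have : (⌊a * N⌋ : ℝ) ≤ R * N := hfl.trans (by nlinarith)
        exact_mod_cast this
    have h4 := h1 _ hk
    have h5 := mono (Set.Icc (⌊a * N⌋ / N : ℝ) (⌊a * N⌋ / N + 2 * (γ + 1 / (2 * N)))) ?_
    · have e : (N : ℝ) * (p + f 0 / N) = N * p + f 0 := by field_simp
      rw [e] at h4
      linarith
    · refine Set.Icc_subset_Icc ((div_le_iff₀ hN0).mpr hfl) ?_
      have : a ≤ (⌊a * N⌋ + 1 : ℝ) / N := (le_div_iff₀ hN0).mpr hfl'.le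
      have e : (⌊a * N⌋ / N + 2 * (γ + 1 / (2 * N)) : ℝ) = (⌊a * N⌋ + 1) / N + 2 * γ := by
        field_simp; ring
      rw [e]
      linarith
  · have hc : (Finset.Icc (-(R * N : ℤ)) (R * N)).card = 2 * R * N + 1 := by
      rw [Int.card_Icc]
      have : (R * N : ℤ) + 1 - -(R * N) = ((2 * R * N + 1 : ℕ) : ℤ) := by push_cast; ring
      rw [this, Int.toNat_natCast]
    rw [hc]
    push_cast
    have h1 : (0 : ℝ) ≤ N := N.cast_nonneg
    have h2 : (0 : ℝ) ≤ R := R.cast_nonneg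
    have h3 : (N : ℝ) + 1 ≤ (N + 1) ^ 2 := by nlinarith
    have h4 := mul_le_mul_of_nonneg_left h3 (show 0 ≤ 2 * (R : ℝ) + 1 by positivity)
    nlinarith
  · filter_upwards [eventually_ge_atTop 1] with N hN k _
    have hN0 : (0 : ℝ) < N := by exact_mod_cast hN
    rw [hf.real_singleLaw measurableSet_Icc]
    refine (hf.setIntegral_Icc_le _ (by positivity)).trans
      ((hf.setIntegral_Icc_neg_add_le hγ.le (by positivity)).trans (le_of_eq ?_))
    rw [hp]
    field_simp

/-- Upper bound on the size of the largest cluster. -/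
theorem IsSymmUnimodalDensity.whp_clusterSize_le {f : ℝ → ℝ}
    (hf : IsSymmUnimodalDensity f) {γ : ℝ} (hγ : 0 < γ) {c : ℝ}
    (hc : c < Real.pi) {ε : ℝ} (hε : 0 < ε) :
    WithHighProbability f fun N ω => (clusterSize γ ω c : ℝ) ≤
      N * (∫ x in (-γ)..γ, f x) + (f 0 + 1) * (N : ℝ) ^ (1 / 2 + ε) := by
  refine (hf.whp_forall_window hγ hε).mono (Eventually.of_forall fun N ω h => ?_)
  obtain ⟨a, ha⟩ := exists_clusterSize_le_card hγ.le ω hc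
  refine le_trans ?_ (h a)
  rw [countIn, Set.ncard_eq_toFinset_card', Set.toFinset_ofPred]
  exact_mod_cast ha

/-! ### The threshold and the smallest intersection -/

/-- `h̃(ρ)` as the maximum of `2 s ((1 - ρ) (1 - 2 s²) - ρ)`, attained at
`s² = (1 - 2 ρ) / (6 (1 - ρ))`. -/
theorem hTilde_eq {ρ : ℝ} (h : ρ ≤ 1 / 2) {s : ℝ}
    (hs : s = Real.sqrt ((1 - 2 * ρ) / (6 * (1 - ρ)))) :
    hTilde ρ = 2 * s * ((1 - ρ) * (1 - 2 * s ^ 2) - ρ) := by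
  have h1 : 0 < 1 - ρ := by linarith
  have h2 : 0 ≤ (2 - 4 * ρ) / 3 := by linarith
  have hsq : s ^ 2 = (1 - 2 * ρ) / (6 * (1 - ρ)) := by
    rw [hs, Real.sq_sqrt (div_nonneg (by linarith) (by linarith))]
  have e1 : ((2 - 4 * ρ) / 3) ^ (3 / 2 : ℝ) = (2 - 4 * ρ) / 3 * Real.sqrt ((2 - 4 * ρ) / 3) := by
    rw [show (3 / 2 : ℝ) = 1 + 1 / 2 by norm_num,
      Real.rpow_add_of_nonneg h2 (by norm_num) (by norm_num), Real.rpow_one, Real.sqrt_eq_rpow]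
  have e2 : Real.sqrt (1 / (1 - ρ)) * Real.sqrt ((2 - 4 * ρ) / 3) = 2 * s := by
    rw [← Real.sqrt_mul (by positivity), hs,
      show 1 / (1 - ρ) * ((2 - 4 * ρ) / 3) = 2 ^ 2 * ((1 - 2 * ρ) / (6 * (1 - ρ))) by
        field_simp; ring,
      Real.sqrt_mul (by norm_num), Real.sqrt_sq (by norm_num)]
  have e3 : (1 - ρ) * (1 - 2 * s ^ 2) - ρ = (2 - 4 * ρ) / 3 := by
    rw [hsq]; field_simp; ring
  rw [hTilde, e1, e3, ← e2]
  ring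

theorem continuousOn_hTilde : ContinuousOn hTilde (Set.Iio 1) := by
  unfold hTilde
  refine ContinuousOn.mul (ContinuousOn.sqrt (continuousOn_const.div (by fun_prop) ?_)) ?_
  · intro x hx
    have : x < 1 := hx
    linarith
  · exact ContinuousOn.rpow_const (by fun_prop) fun x _ => Or.inr (by norm_num)

theorem hTilde_half : hTilde (1 / 2) = 0 := by
  rw [hTilde, show ((2 : ℝ) - 4 * (1 / 2)) / 3 = 0 by norm_num,
    Real.zero_rpow (by norm_num), mul_zero]

theorem hTilde_pos {ρ : ℝ} (h : ρ < 1 / 2) : 0 < hTilde ρ :=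
  mul_pos (Real.sqrt_pos.mpr (one_div_pos.mpr (by linarith)))
    (Real.rpow_pos_of_pos (by linarith) _)

/-- The probability of the interval of length `x` centred at `0`. -/
noncomputable def centralMass (f : ℝ → ℝ) (x : ℝ) : ℝ := ∫ w in (-(x / 2))..(x / 2), f w

theorem IsSymmUnimodalDensity.strictMonoOn_centralMass {f : ℝ → ℝ}
    (hf : IsSymmUnimodalDensity f) :
    StrictMonoOn (centralMass f) (Set.Ici 0) := by
  have hii : ∀ a b : ℝ, IntervalIntegrable f volume a b :=
    fun a b => hf.integrable.intervalIntegrable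
  intro a ha b _ hab
  have ha' : (0 : ℝ) ≤ a := ha
  unfold centralMass
  rw [← intervalIntegral.integral_add_adjacent_intervals (hii (-(b / 2)) (-(a / 2))) (hii _ _),
    ← intervalIntegral.integral_add_adjacent_intervals (hii (-(a / 2)) (a / 2)) (hii _ (b / 2))]
  have p1 : 0 < ∫ w in (-(b / 2))..(-(a / 2)), f w :=
    intervalIntegral.intervalIntegral_pos_of_pos (hii _ _) hf.pos (by linarith)
  have p2 : 0 < ∫ w in (a / 2)..(b / 2), f w :=
    intervalIntegral.intervalIntegral_pos_of_pos (hii _ _) hf.pos (by linarith)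
  linarith

theorem IsSymmUnimodalDensity.continuous_centralMass {f : ℝ → ℝ}
    (hf : IsSymmUnimodalDensity f) : Continuous (centralMass f) := by
  have hii : ∀ a b : ℝ, IntervalIntegrable f volume a b :=
    fun a b => hf.integrable.intervalIntegrable
  have hc : Continuous fun b => ∫ w in (0 : ℝ)..b, f w :=
    intervalIntegral.continuous_primitive hii 0
  have e : centralMass f =
      fun x => (∫ w in (0 : ℝ)..(x / 2), f w) - ∫ w in (0 : ℝ)..(-(x / 2)), f w := by
    funext x
    exact (intervalIntegral.integral_interval_sub_left (hii _ _) (hii _ _)).symm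
  rw [e]
  exact (hc.comp (by fun_prop)).sub (hc.comp (by fun_prop))

theorem IsSymmUnimodalDensity.tendsto_centralMass {f : ℝ → ℝ}
    (hf : IsSymmUnimodalDensity f) : Tendsto (centralMass f) atTop (𝓝 1) := by
  have t : Tendsto (fun x : ℝ => x / 2) atTop atTop := tendsto_id.atTop_div_const (by norm_num)
  have := intervalIntegral_tendsto_integral hf.integrable (tendsto_neg_atTop_atBot.comp t) t
  rwa [hf.integral_eq_one] at this

theorem IsSymmUnimodalDensity.centralMass_lt_one {f : ℝ → ℝ}
    (hf : IsSymmUnimodalDensity f) {x : ℝ} (hx : 0 ≤ x) : centralMass f x < 1 := by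
  have h := hf.strictMonoOn_centralMass
  refine (h hx (show x + 1 ∈ Set.Ici 0 from add_nonneg hx zero_le_one) (lt_add_one x)).trans_le ?_
  refine ge_of_tendsto hf.tendsto_centralMass ?_
  filter_upwards [eventually_ge_atTop (x + 1)] with y hy
  exact h.monotoneOn (add_nonneg hx zero_le_one) ((add_nonneg hx zero_le_one).trans hy) hy

theorem centralMass_zero {f : ℝ → ℝ} : centralMass f 0 = 0 := by simp [centralMass]

theorem IsSymmUnimodalDensity.gInf_spec {f : ℝ → ℝ}
    (hf : IsSymmUnimodalDensity f) {ρ : ℝ} (h0 : 0 < ρ) (h1 : ρ ≤ 1) :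
    0 ≤ gInf f ρ ∧ centralMass f (gInf f ρ) = 1 - ρ :=
  (gInf_eq_iff hf h0 h1 _).mp rfl

theorem IsSymmUnimodalDensity.gInf_one_sub_centralMass {f : ℝ → ℝ}
    (hf : IsSymmUnimodalDensity f) {x : ℝ} (hx : 0 ≤ x) :
    gInf f (1 - centralMass f x) = x := by
  have h1 := hf.centralMass_lt_one hx
  have h0 := hf.strictMonoOn_centralMass.monotoneOn Set.self_mem_Ici hx hx
  rw [centralMass_zero] at h0
  exact (gInf_eq_iff hf (by linarith) (by linarith) x).mpr
    ⟨hx, by rw [sub_sub_cancel]; rfl⟩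

/-- In terms of `x = g_∞(ρ)`, the intersections are the solutions of `x = γ h̃(1 - I(x))`, `I(x)`
being the probability of the interval of length `x` centred at `0`. -/
theorem IsSymmUnimodalDensity.mem_intersections_iff {f : ℝ → ℝ}
    (hf : IsSymmUnimodalDensity f) {γ ρ : ℝ} :
    ρ ∈ intersections f γ ↔ ∃ x, gInf f (1 / 2) ≤ x ∧ ρ = 1 - centralMass f x ∧
      x = γ * hTilde (1 - centralMass f x) := by
  obtain ⟨b0, b1⟩ := hf.gInf_spec (ρ := 1 / 2) (by norm_num) (by norm_num)
  constructor
  · rintro ⟨⟨h0, h1⟩, h⟩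
    obtain ⟨g0, g1⟩ := hf.gInf_spec h0 (by linarith)
    refine ⟨gInf f ρ, (hf.strictMonoOn_centralMass.le_iff_le b0 g0).mp (by linarith),
      by linarith, ?_⟩
    rw [g1, sub_sub_cancel]
    exact h
  · rintro ⟨x, hx, rfl, h⟩
    have hx0 := b0.trans hx
    refine ⟨⟨by linarith [hf.centralMass_lt_one hx0], ?_⟩, ?_⟩
    · linarith [hf.strictMonoOn_centralMass.monotoneOn b0 hx0 hx]
    · rw [hf.gInf_one_sub_centralMass hx0]
      exact h

theorem IsSymmUnimodalDensity.gInf_half_pos {f : ℝ → ℝ}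
    (hf : IsSymmUnimodalDensity f) : 0 < gInf f (1 / 2) := by
  obtain ⟨b0, b1⟩ := hf.gInf_spec (ρ := 1 / 2) (by norm_num) (by norm_num)
  refine b0.lt_of_ne fun h => ?_
  rw [← h, centralMass_zero] at b1
  norm_num at b1

/-- The ratio of `h̃` and `g_∞`, as a function of `x = g_∞(ρ)`: it is continuous, vanishes at both
ends, and is positive inside. -/
theorem IsSymmUnimodalDensity.ratio_props {f : ℝ → ℝ}
    (hf : IsSymmUnimodalDensity f) :
    ContinuousOn (fun x => hTilde (1 - centralMass f x) / x) (Set.Ici (gInf f (1 / 2))) ∧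
    Tendsto (fun x => hTilde (1 - centralMass f x) / x) atTop (𝓝 0) ∧
    hTilde (1 - centralMass f (gInf f (1 / 2))) / gInf f (1 / 2) = 0 ∧
    ∀ x, gInf f (1 / 2) < x → 0 < hTilde (1 - centralMass f x) / x := by
  obtain ⟨b0, b1⟩ := hf.gInf_spec (ρ := 1 / 2) (by norm_num) (by norm_num)
  have bpos := hf.gInf_half_pos
  refine ⟨?_, ?_, ?_, ?_⟩
  · refine ContinuousOn.div (continuousOn_hTilde.comp
      (continuous_const.sub hf.continuous_centralMass).continuousOn fun x hx => ?_)
      continuousOn_id fun x hx => (bpos.trans_le hx).ne'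
    have := hf.strictMonoOn_centralMass.monotoneOn b0 (b0.trans hx) hx
    simp only [Set.mem_Iio]
    linarith
  · have h1 : Tendsto (fun x => hTilde (1 - centralMass f x)) atTop (𝓝 (hTilde 0)) := by
      refine (continuousOn_hTilde.continuousAt (Iio_mem_nhds zero_lt_one)).tendsto.comp ?_
      simpa using (tendsto_const_nhds (x := (1 : ℝ))).sub hf.tendsto_centralMass
    exact h1.div_atTop tendsto_id
  · rw [b1, sub_sub_cancel, hTilde_half, zero_div]
  · intro x hx
    have := hf.strictMonoOn_centralMass b0 (b0.trans hx.le) hx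
    exact div_pos (hTilde_pos (by linarith)) (bpos.trans hx)

/-- The maximum of `q` is attained at some `m`, and `γ* = 1 / q m`. For larger `γ` the function `γ
q` exceeds `1` at `m` and tends to `0`, so its level set at `1` is nonempty, closed and bounded. The
largest point of that set gives the smallest `ρ`, since `1 - centralMass f x` decreases in `x`. -/
theorem IsSymmUnimodalDensity.threshold {f : ℝ → ℝ}
    (hf : IsSymmUnimodalDensity f) :
    IsLeast {γ : ℝ | (intersections f γ).Nonempty} (gammaStar f) ∧ 0 < gammaStar f ∧
    ∀ γ, gammaStar f < γ → IsLeast (intersections f γ) (rhoMin f γ) := by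
  obtain ⟨hcont, hlim, hzero, hpos⟩ := hf.ratio_props
  set q : ℝ → ℝ := fun x => hTilde (1 - centralMass f x) / x with hq
  set b := gInf f (1 / 2) with hb
  have bpos : 0 < b := hf.gInf_half_pos
  have hsol : ∀ γ x, b ≤ x → (x = γ * hTilde (1 - centralMass f x) ↔ γ * q x = 1) := by
    intro γ x hx
    rw [hq, ← mul_div_assoc, div_eq_one_iff_eq (bpos.trans_le hx).ne', eq_comm]
  obtain ⟨m, hm, hmax⟩ : ∃ m ∈ Set.Ici b, IsMaxOn q (Set.Ici b) m := by
    refine hcont.exists_isMaxOn' isClosed_Ici (x₀ := b + 1)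
      (show b ≤ b + 1 by linarith) ?_
    have h1 : ∀ᶠ x in atTop, q x ≤ q (b + 1) := hlim.eventually (ge_mem_nhds (hpos _ (by linarith)))
    obtain ⟨X, hX⟩ := eventually_atTop.mp h1
    rw [eventually_inf_principal]
    filter_upwards [isCompact_Icc (a := b) (b := X) |>.compl_mem_cocompact] with x hx hxb
    refine hX x ?_
    by_contra! h
    exact hx ⟨hxb, h.le⟩
  have hqm : 0 < q m := (hpos (b + 1) (by linarith)).trans_le (hmax (show b ≤ b + 1 by linarith))
  have hleast : IsLeast {γ : ℝ | (intersections f γ).Nonempty} (1 / q m) := by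
    constructor
    · exact ⟨_, hf.mem_intersections_iff.mpr ⟨m, hm, rfl, (hsol _ m hm).mpr (by field_simp)⟩⟩
    · rintro γ ⟨ρ, hρ⟩
      obtain ⟨x, hx, -, h⟩ := hf.mem_intersections_iff.mp hρ
      rw [hsol γ x hx] at h
      have hle : q x ≤ q m := hmax hx
      have hqx : 0 ≤ q x := by
        rcases hx.lt_or_eq with h' | h'
        · exact (hpos x h').le
        · rw [← h']; exact hzero.ge
      -- The competing `γ` range over all reals; nonpositive ones cannot satisfy `γ * q x = 1` with
      -- `q x ≥ 0`.
      have hγ : 0 < γ := by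
        by_contra! h0
        linarith [mul_nonpos_of_nonpos_of_nonneg h0 hqx]
      rw [div_le_iff₀ hqm, ← h]
      exact mul_le_mul_of_nonneg_left hle hγ.le
  have hstar : gammaStar f = 1 / q m := hleast.csInf_eq
  rw [hstar]
  refine ⟨hleast, by positivity, fun γ hγ => ?_⟩
  have hγm : 1 < γ * q m := (div_lt_iff₀ hqm).mp hγ
  set Z := {x | b ≤ x ∧ γ * q x = 1} with hZ
  have hlimγ : Tendsto (fun x => γ * q x) atTop (𝓝 0) := by simpa using hlim.const_mul γ
  have hev : ∀ᶠ x in atTop, γ * q x < 1 := hlimγ.eventually (gt_mem_nhds zero_lt_one)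
  obtain ⟨X, hX⟩ := eventually_atTop.mp hev
  have hcontγ : ContinuousOn (fun x => γ * q x) (Set.Ici b) := continuousOn_const.mul hcont
  have hZne : Z.Nonempty := by
    obtain ⟨x, hx, e⟩ := intermediate_value_Icc' (le_max_left m X)
      (hcontγ.mono fun y hy => hm.trans hy.1)
      (show (1 : ℝ) ∈ Set.Icc (γ * q (max m X)) (γ * q m) from
        ⟨(hX _ (le_max_right _ _)).le, hγm.le⟩)
    exact ⟨x, hm.trans hx.1, e⟩
  have hZbdd : BddAbove Z := by
    refine ⟨X, fun x hx => ?_⟩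
    by_contra! h
    exact absurd hx.2 (hX x h.le).ne
  have hZclosed : IsClosed Z :=
    hcontγ.preimage_isClosed_of_isClosed isClosed_Ici isClosed_singleton
  obtain ⟨hx1, hx2⟩ := hZclosed.csSup_mem hZne hZbdd
  have hmem := hf.mem_intersections_iff.mpr ⟨sSup Z, hx1, rfl, (hsol γ _ hx1).mpr hx2⟩
  have hl : IsLeast (intersections f γ) (1 - centralMass f (sSup Z)) := by
    refine ⟨hmem, fun ρ hρ => ?_⟩
    obtain ⟨x, hx, rfl, h⟩ := hf.mem_intersections_iff.mp hρ
    have hxZ : x ∈ Z := ⟨hx, (hsol γ x hx).mp h⟩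
    have := hf.strictMonoOn_centralMass.monotoneOn (bpos.le.trans hx) (bpos.le.trans hx1)
      (le_csSup hZbdd hxZ)
    linarith
  rwa [rhoMin, hl.csInf_eq]

/-! ### Clusters above the threshold -/

/-- Keeps the radius small enough for the lifting condition `3 * r ≤ 2 * π`. -/
theorem two_mul_arcsin_sqrt_le : 2 * Real.arcsin (Real.sqrt (1 / 6)) ≤ Real.pi / 3 := by
  have hpi := Real.pi_pos
  have h : Real.sqrt (1 / 6) ≤ Real.sin (Real.pi / 6) := by
    rw [Real.sin_pi_div_six]
    exact Real.sqrt_le_iff.mpr ⟨by norm_num, by norm_num⟩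
  have := (Real.arcsin_le_iff_le_sin' ⟨by linarith, by linarith⟩).mpr h
  linarith

/-- The oscillators with frequency in an interval of length `x` form a cluster, if there are
enough of them. -/
theorem exists_isInvariantRegion {N : ℕ} {γ r κ x : ℝ} (hγ : 0 ≤ γ) (hr0 : 0 ≤ r)
    (hr : 3 * r ≤ 2 * Real.pi) (hcos : 0 ≤ Real.cos (r / 2))
    (hx : x < γ * (2 * Real.sin (r / 2) * (κ * (1 + Real.cos (r / 2)) - 1)))
    (ω : Fin N → ℝ) (hω : κ * N ≤ countIn ω (Set.Icc (-(x / 2)) (x / 2))) :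
    ∃ S : Finset (Fin N), S.card = countIn ω (Set.Icc (-(x / 2)) (x / 2)) ∧
      IsInvariantRegion γ ω r S := by
  classical
  refine ⟨Finset.univ.filter fun i => ω i ∈ Set.Icc (-(x / 2)) (x / 2), ?_, ?_⟩
  · rw [countIn, Set.ncard_eq_toFinset_card', Set.toFinset_ofPred]
  set S := Finset.univ.filter fun i => ω i ∈ Set.Icc (-(x / 2)) (x / 2) with hS
  have hcard : κ * N ≤ S.card := by
    rwa [countIn, Set.ncard_eq_toFinset_card', Set.toFinset_ofPred] at hω
  refine isInvariantRegion_of_sub_lt hγ hr0 hr fun i hi j hj => ?_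
  have hN : (0 : ℝ) < N := by exact_mod_cast i.pos
  have hs : 0 ≤ Real.sin (r / 2) :=
    Real.sin_nonneg_of_nonneg_of_le_pi (by linarith) (by linarith)
  have hi' : ω i ≤ x / 2 := (Finset.mem_filter.mp hi).2.2
  have hj' : -(x / 2) ≤ ω j := (Finset.mem_filter.mp hj).2.1
  have e : γ * (2 * Real.sin (r / 2) * (κ * (1 + Real.cos (r / 2)) - 1)) =
      γ / N * (2 * Real.sin (r / 2) * (κ * N * (1 + Real.cos (r / 2)) - N)) := by
    field_simp
  have h1 : κ * N * (1 + Real.cos (r / 2)) - N ≤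
      S.card * Real.cos (r / 2) - (N - S.card) := by
    have := mul_le_mul_of_nonneg_right hcard (show 0 ≤ 1 + Real.cos (r / 2) by linarith)
    linarith
  have h2 := mul_le_mul_of_nonneg_left (mul_le_mul_of_nonneg_left h1
    (show 0 ≤ 2 * Real.sin (r / 2) by positivity)) (show 0 ≤ γ / (N : ℝ) by positivity)
  linarith

/-- At an intersection the cluster condition holds with room to spare. -/
theorem exists_radius_and_fraction {γ ρ x : ℝ} (hγ : 0 < γ) (hρ0 : 0 < ρ) (hρ : ρ < 1 / 2)
    (hx : x = γ * hTilde ρ) :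
    ∃ r κ : ℝ, 0 < r ∧ r ≤ 2 * Real.arcsin (Real.sqrt (1 / 6)) ∧ 0 ≤ Real.cos (r / 2) ∧
      0 < κ ∧ κ < 1 - ρ ∧
      x < γ * (2 * Real.sin (r / 2) * (κ * (1 + Real.cos (r / 2)) - 1)) := by
  -- `s` is the maximiser in `hTilde_eq`, and `r` is chosen with `sin (r / 2) = s`; `s² ≤ 1/6` gives
  -- the bound on `r`.
  set s := Real.sqrt ((1 - 2 * ρ) / (6 * (1 - ρ))) with hs
  have hquot : 0 < (1 - 2 * ρ) / (6 * (1 - ρ)) := div_pos (by linarith) (by linarith)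
  have hs0 : 0 < s := Real.sqrt_pos.mpr hquot
  have hle : (1 - 2 * ρ) / (6 * (1 - ρ)) ≤ 1 / 6 := by
    rw [div_le_div_iff₀ (by linarith) (by norm_num)]
    linarith
  have hsq : s ^ 2 ≤ 1 / 6 := by rwa [hs, Real.sq_sqrt hquot.le]
  have hs1 : s ≤ 1 := by nlinarith
  have hr : 2 * Real.arcsin s / 2 = Real.arcsin s := by ring
  -- This is `cos r < cos (r / 2)`, the source of the strict inequality at the intersection and of a
  -- `κ` strictly below `1 - ρ`.
  have hlt : 1 - 2 * s ^ 2 < Real.sqrt (1 - s ^ 2) := by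
    refine Real.lt_sqrt_of_sq_lt ?_
    nlinarith [pow_pos hs0 2]
  have hx' : x < γ * (2 * s * ((1 - ρ) * (1 + Real.sqrt (1 - s ^ 2)) - 1)) := by
    rw [hx, hTilde_eq hρ.le hs]
    have := mul_lt_mul_of_pos_left hlt (show 0 < 1 - ρ by linarith)
    exact mul_lt_mul_of_pos_left (mul_lt_mul_of_pos_left (by linarith) (by positivity)) hγ
  have hev : ∀ᶠ κ in 𝓝[<] (1 - ρ),
      x < γ * (2 * s * (κ * (1 + Real.sqrt (1 - s ^ 2)) - 1)) := by
    have hcont : Continuous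
        fun κ => γ * (2 * s * (κ * (1 + Real.sqrt (1 - s ^ 2)) - 1)) := by fun_prop
    exact nhdsWithin_le_nhds (hcont.continuousAt.tendsto.eventually (lt_mem_nhds hx'))
  obtain ⟨κ, h1, h2⟩ :=
    (hev.and (Ioo_mem_nhdsLT (show 0 < 1 - ρ by linarith))).exists
  refine ⟨2 * Real.arcsin s, κ, ?_, ?_, ?_, h2.1, h2.2, ?_⟩
  · have := Real.arcsin_pos.mpr hs0
    linarith
  · have := Real.arcsin_le_arcsin (Real.sqrt_le_sqrt hle)
    linarith
  · rw [hr]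
    exact Real.cos_arcsin_nonneg s
  · rw [hr, Real.sin_arcsin (by linarith) hs1, Real.cos_arcsin]
    exact h1

/-- Above the threshold, with high probability there is an invariant region for a cluster of at
least `(1 - ρ_min) N - N ^ (1/2 + ε)` oscillators, and of a fixed positive fraction of them. -/
theorem IsSymmUnimodalDensity.whp_exists_isInvariantRegion {f : ℝ → ℝ}
    (hf : IsSymmUnimodalDensity f) {γ : ℝ} (hγ0 : 0 < γ) (hγ : gammaStar f < γ) :
    ∃ r κ : ℝ, 0 < r ∧ r ≤ 2 * Real.arcsin (Real.sqrt (1 / 6)) ∧ 0 < κ ∧ ∀ ε : ℝ, 0 < ε →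
      WithHighProbability f fun N ω => ∃ S : Finset (Fin N), κ * N ≤ S.card ∧
        (1 - rhoMin f γ) * N - (N : ℝ) ^ (1 / 2 + ε) ≤ S.card ∧ IsInvariantRegion γ ω r S := by
  obtain ⟨⟨hρ0, hρ1⟩, hx⟩ := (hf.threshold.2.2 γ hγ).1
  set ρ := rhoMin f γ
  obtain ⟨hg0, hg⟩ := hf.gInf_spec hρ0 (by linarith)
  set x := gInf f ρ with hxdef
  -- At `ρ = 1/2` the right side `γ * hTilde ρ` vanishes while `g_∞` is positive.
  have hρ : ρ < 1 / 2 := by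
    refine hρ1.lt_of_ne fun h => ?_
    rw [hxdef, h, hTilde_half, mul_zero] at hx
    exact hf.gInf_half_pos.ne' hx
  obtain ⟨r, κ, hr0, hr, hcos, hκ0, hκ, hlt⟩ := exists_radius_and_fraction hγ0 hρ0 hρ hx
  refine ⟨r, κ, hr0, hr, hκ0, fun ε hε => ?_⟩
  have hmass : (singleLaw f).real (Set.Icc (-(x / 2)) (x / 2)) = 1 - ρ := by
    rw [hf.real_singleLaw measurableSet_Icc, integral_Icc_eq_integral_Ioc,
      ← intervalIntegral.integral_of_le (by linarith)]
    exact hg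
  have h1 := hf.whp_lt_countIn (A := Set.Icc (-(x / 2)) (x / 2)) measurableSet_Icc hε
  -- Any exponent below `1` serves here: the deviation `N ^ (3/4)` is eventually below the margin
  -- `(1 - ρ - κ) N`, whatever the given `ε`.
  have h2 := hf.whp_lt_countIn (A := Set.Icc (-(x / 2)) (x / 2)) measurableSet_Icc
    (show (0 : ℝ) < 1 / 4 by norm_num)
  rw [hmass] at h1 h2
  have hsmall : ∀ᶠ N : ℕ in atTop, (N : ℝ) ^ (1 / 2 + 1 / 4 : ℝ) ≤ (1 - ρ - κ) * N := by
    have h := ((tendsto_rpow_neg_atTop (show (0 : ℝ) < 1 / 4 by norm_num)).comp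
      tendsto_natCast_atTop_atTop).eventually (ge_mem_nhds (show 0 < 1 - ρ - κ by linarith))
    filter_upwards [h, eventually_ge_atTop 1] with N hN hN1
    have hN0 : (0 : ℝ) < N := by exact_mod_cast hN1
    rw [show (1 / 2 + 1 / 4 : ℝ) = -(1 / 4) + 1 by norm_num, Real.rpow_add_one hN0.ne']
    exact mul_le_mul_of_nonneg_right hN hN0.le
  refine (h1.and h2).mono ?_
  filter_upwards [hsmall] with N hN ω hω
  have hcount : κ * N ≤ countIn ω (Set.Icc (-(x / 2)) (x / 2)) := by linarith [hω.2]
  obtain ⟨S, hS, hinv⟩ := exists_isInvariantRegion hγ0.le hr0.le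
    (by linarith [two_mul_arcsin_sqrt_le, Real.pi_pos]) hcos hlt ω hcount
  exact ⟨S, by rwa [hS], by rw [hS]; exact hω.1.le, hinv⟩

end Kuramoto

theorem mainTheorem3 (f : ℝ → ℝ) (hf : Kuramoto.IsSymmUnimodalDensity f)
    (c : ℝ) (hc : 2 * Real.arcsin (Real.sqrt (1 / 6)) ≤ c) (hcπ : c < Real.pi) :
    -- the smallest coupling strength with an intersection exists
    IsLeast {γ : ℝ | (Kuramoto.intersections f γ).Nonempty} (Kuramoto.gammaStar f) ∧
    0 < Kuramoto.gammaStar f ∧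
    ∀ γ : ℝ, 0 < γ →
      -- upper bound on the size of the largest partially entrained cluster
      (∀ ε : ℝ, 0 < ε → ∃ C : ℝ, 0 < C ∧
        Kuramoto.WithHighProbability f (fun N ω =>
          (Kuramoto.clusterSize γ ω c : ℝ) ≤
            (N : ℝ) * (∫ x in (-γ)..γ, f x) + C * (N : ℝ) ^ (1 / 2 + ε))) ∧
      (Kuramoto.gammaStar f < γ →
        -- the smallest intersection exists
        IsLeast (Kuramoto.intersections f γ) (Kuramoto.rhoMin f γ) ∧
        -- existence of a partially entrained state with a positive fraction of the oscillators
        (∃ δ : ℝ, 0 < δ ∧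
          Kuramoto.WithHighProbability f (fun N ω =>
            ∃ S : Finset (Fin N), δ * (N : ℝ) ≤ (S.card : ℝ) ∧ Kuramoto.IsEntrained γ ω c S)) ∧
        -- lower bound on the size of the largest partially entrained cluster
        (∀ ε : ℝ, 0 < ε → ∃ C : ℝ, 0 < C ∧
          Kuramoto.WithHighProbability f (fun N ω =>
            (1 - Kuramoto.rhoMin f γ) * (N : ℝ) - C * (N : ℝ) ^ (1 / 2 + ε) ≤
              (Kuramoto.clusterSize γ ω c : ℝ))) ∧
        -- a cluster of that size has a forward invariant region of a size independent of `N`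
        (∃ r : ℝ, 0 < r ∧ r ≤ 2 * Real.arcsin (Real.sqrt (1 / 6)) ∧
          ∀ ε : ℝ, 0 < ε → ∃ C : ℝ, 0 < C ∧
            Kuramoto.WithHighProbability f (fun N ω =>
              ∃ S : Finset (Fin N),
                (1 - Kuramoto.rhoMin f γ) * (N : ℝ) - C * (N : ℝ) ^ (1 / 2 + ε) ≤ (S.card : ℝ) ∧
                Kuramoto.IsInvariantRegion γ ω r S))) := by
  obtain ⟨h1, h2, h3⟩ := hf.threshold
  refine ⟨h1, h2, fun γ hγ => ⟨fun ε hε => ?_, fun hγs => ?_⟩⟩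
  · exact ⟨f 0 + 1, by linarith [hf.pos 0], hf.whp_clusterSize_le hγ hcπ hε⟩
  obtain ⟨r, κ, hr0, hr, hκ, h⟩ := hf.whp_exists_isInvariantRegion hγ hγs
  refine ⟨h3 γ hγs, ⟨κ, hκ, ?_⟩, fun ε hε => ⟨1, one_pos, ?_⟩,
    r, hr0, hr, fun ε hε => ⟨1, one_pos, ?_⟩⟩
  -- The fraction `κ` does not depend on `ε`, so any value of `ε` will do.
  · refine (h 1 one_pos).mono (Filter.Eventually.of_forall fun N ω => ?_)
    rintro ⟨S, hS, -, hinv⟩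
    exact ⟨S, hS, hinv.isEntrained hr0 (hr.trans hc)⟩
  · refine (h ε hε).mono (Filter.Eventually.of_forall fun N ω => ?_)
    rintro ⟨S, -, hS, hinv⟩
    rw [one_mul]
    exact hS.trans (by exact_mod_cast (hinv.isEntrained hr0 (hr.trans hc)).card_le_clusterSize)
  · refine (h ε hε).mono (Filter.Eventually.of_forall fun N ω => ?_)
    rintro ⟨S, -, hS, hinv⟩
    rw [one_mul]
    exact ⟨S, hS, hinv⟩
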